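/- **Theorem (Convergence of pseudo-VNE to VWE).** *Notation.* Fix $T\in\mathbb N$, $M>0$, $B_{\mathbf f}>0$ and put $\mathcal M=[0,M+1]^T\subset\mathbb R^T$ (Euclidean norm). For a function $\varphi$ on $C\subset\mathbb R^T$, $\partial\varphi(x)=\{g:\varphi(z)\ge\varphi(x)+\langle g,z-x\rangle\ \forall z\in C\}$; $\partial_1$ is the subdifferential in the first variable. $d_H$ is the Hausdorff distance, $\mathrm{ri}$ the relative interior in the affine hull, and $\mathrm{rbd}\,C$ the boundary of $C$ in the linear span of $C$ (with $d(x,\emptyset)=+\infty$). *Nonatomic game $\mathcal G$.* Players $\theta\in\Theta=[0,1]$ (Lebesgue measure) have action sets $\mathcal X_\theta\subset\mathbb R^T_{+}$ and costs $f_\theta(x,Y)$, where $x$ is the own action and $Y$ the aggregate action. Assume: - each $\mathcal X_\theta$ is nonempty, convex, compact and contained in the closed ball of radius $M$ around $0$, and $\{(\theta,x):x\in\mathcal X_\theta\}$ is a Borel set; - there is a neighbourhood $\mathcal M'$ of $\mathcal M$ such that for every $Y\in\mathcal M$: $\theta\mapsto f_\theta(x,Y)$ is measurable for every $x\in\mathcal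 M'$; $f_\theta(\cdot,Y)$ is continuous and convex on $\mathcal M'$ for every $\theta$; and $\|g\|\le B_{\mathbf f}$ for all $g\in\partial_1f_\theta(x,Y)$, $x\in\mathcal M$, $\theta\in\Theta$. Moreover each $f_\theta$ is bounded on $\mathcal M^2$, and $f_\theta(x,\cdot)$ is continuous on $\mathcal M$ for every $x\in\mathcal M$. Let $\mathcal X=\{x\in L^2([0,1],\mathbb R^T):x_\theta\in\mathcal X_\theta\text{ a.e.}\}$, let $\overline{\mathcal X}=\{\int x:x\in\mathcal X\}$, and for $A\subset\mathbb R^T$ let $\mathcal X(A)=\{x\in\mathcal X:\int x\in A\}$. Assume also that for all $Y\in\overline{\mathcal X}$ and all $x\in\mathcal X$ with $x_\theta\in\arg\min_{\mathcal X_\theta}f_\theta(\cdot,Y)$ for every $\theta$, the correspondence $\theta\mapsto\{g\in\partial_1f_\theta(x_\theta,Y):\langle g,y-x_\theta\rangle\ge0\ \forall y\in\mathcal X_\theta\}$ is measurable. Let $H(x)$ be the set of all $\mathbf g\in L^2([0,1],\mathbb R^T)$ with $\mathbf g_\theta\in\partial_1f_\theta(x_\theta,\int x)$ for a.e. $\theta$.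 A *variational Wardrop equilibrium* (VWE) of $\mathcal G(A)$ is an $x^*\in\mathcal X(A)$ for which some $\mathbf g\in H(x^*)$ satisfies $\int_\Theta\langle\mathbf g_\theta,x_\theta-x^*_\theta\rangle\,d\theta\ge0$ for all $x\in\mathcal X(A)$. The game $\mathcal G$ is *strongly monotone with modulus $\alpha$* (resp. *aggregatively strongly monotone with modulus $\beta$*) if $\int_\Theta\langle\mathbf g_\theta-\mathbf h_\theta,x_\theta-y_\theta\rangle\,d\theta$ is at least $\alpha\|x-y\|_2^2$ (resp. $\beta\|\int x-\int y\|^2$) for all $x,y\in L^2([0,1],\mathcal M)$, $\mathbf g\in H(x)$, $\mathbf h\in H(y)$. *Pseudo-AAS.* For each $\nu$ let $\mathcal G^\nu$ be a finite-player game with players $i\in\mathcal I^\nu$, nonempty convex compact action sets $\mathcal X^\nu_i\subset\mathbb R^T_+$ and costs $f^\nu_i(x_i,Y)$; put $\mathcal X^\nu=\prod_i\mathcal X^\nu_i$, $\overline{\mathcal X}^\nu=\{\sum_ix_i:x\in\mathcal X^\nu\}$ and $\mathcal X^\nu(A^\nu)=\{x\in\mathcal X^\nu:\sum_ix_i\in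 A^\nu\}$. Let $[0,1]=\Theta_0^\nu\cup\bigcup_{i\in\mathcal I^\nu}\Theta_i^\nu$ be a measurable partition in which $\Theta_0^\nu$ is null and $\mu_i^\nu=|\Theta^\nu_i|>0$ for $i\in\mathcal I^\nu$. As a function of its first variable, $f_i^\nu$ is defined on a set containing $\mathcal X_i^\nu$ and a neighbourhood of $\mu_i^\nu\mathcal M$; on this set it is convex in $x_i$ for every $Y\in\overline{\mathcal X}^\nu$, and it is jointly continuous in $(x_i,Y)$. The games form a pseudo-AAS of $\mathcal G$ if, as $\nu\to\infty$, $$\overline\delta^\nu=\max_i\sup_{\theta\in\Theta_i^\nu}d_H\big(\mathcal X_\theta,\tfrac1{\mu_i^\nu}\mathcal X_i^\nu\big)\to0,\qquad \overline d^\nu=\max_i\sup_{\theta\in\Theta_i^\nu}\sup_{x,Y\in\mathcal M}d_H\big(\partial_1f_i^\nu(\mu_i^\nu x,Y),\partial_1f_\theta(x,Y)\big)\to0,$$ and $\mathrm{span}\,\mathcal X_i^\nu=\mathrm{span}\,\mathcal X_\theta$ for all $\theta\in\Theta_i^\nu$. With aggregative constraints $A$ and $A^\nu$ (convex compact subsets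 of $\mathbb R^T$) one requires in addition $\mathrm{span}\,A^\nu=\mathrm{span}\,A$ for all $\nu$ and $D^\nu=d_H(A^\nu,A)\to0$. A *pseudo-VNE* of $\mathcal G^\nu(A^\nu)$ is an $\hat x\in\mathcal X^\nu(A^\nu)$ for which there are $\mathbf g_i\in\partial_1f_i^\nu(\hat x_i,\sum_j\hat x_j)$, $i\in\mathcal I^\nu$, with $\sum_i\langle\mathbf g_i,x_i-\hat x_i\rangle\ge0$ for all $x\in\mathcal X^\nu(A^\nu)$. Let $\psi^\nu(x)\in L^2([0,1],\mathbb R^T)$ be the function equal to $x_i/\mu_i^\nu$ on $\Theta_i^\nu$. *Claim with aggregative constraints.* Assume that there are $\eta>0$ and $\bar x\in\mathcal X$ with $d(\bar x_\theta,\mathrm{rbd}\,\mathcal X_\theta)>\eta$ for a.e. $\theta$, and let $A\subset\mathbb R^T$ be convex and compact with $\mathrm{ri}\,A\cap\mathrm{ri}\,\overline{\mathcal X}\neq\emptyset$. Then there are constants $\rho,\bar\rho>0$, depending only on $\mathcal G$ and $A$, such that with $K_A=\frac{M+1}{\min\{\rho,\bar\rho\}}$ the following holds for every pseudo-AAS $(\mathcal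 G^\nu(A^\nu))_\nu$ of $\mathcal G(A)$, every VWE $x^*$ of $\mathcal G(A)$ and all pseudo-VNE $\hat x^\nu$ of $\mathcal G^\nu(A^\nu)$, where $X^*=\int x^*$ and $\hat X^\nu=\sum_i\hat x^\nu_i$. (1) If $\mathcal G$ is aggregatively strongly monotone with modulus $\beta>0$, then $\hat X^\nu\to X^*$, and for all $\nu$ with $2\max(\overline\delta^\nu,D^\nu)<\rho$, $$\|\hat X^\nu-X^*\|^2\le\tfrac1\beta\big((3B_{\mathbf f}+1)K_A\max(D^\nu,\overline\delta^\nu)+(2M+1)\overline d^\nu\big).$$ (2) If $\mathcal G$ is strongly monotone with modulus $\alpha>0$, then $\psi^\nu(\hat x^\nu)\to x^*$ in $L^2$, and for all $\nu$ with $2\max(\overline\delta^\nu,D^\nu)<\rho$, $$\|\psi^\nu(\hat x^\nu)-x^*\|_2^2\le\tfrac1\alpha\big((3B_{\mathbf f}+1)K_A\max(D^\nu,\overline\delta^\nu)+(2M+1)\overline d^\nu\big).$$ *Claim without aggregative constraints* (that is, $\overline{\mathcal X}\subset A$ and $\overline{\mathcal X}^\nu\subset A^\nu$ for all $\nu$).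 There is $\rho>0$ such that (1) and (2) hold with $K_A$ replaced by $1$ and $D^\nu$ replaced by $0$; the hypotheses on $\eta$, $\bar x$, on the relative interiors and on the convergence of $A^\nu$ to $A$ are not needed here. -/

import Mathlib

open MeasureTheory Filter Topology
open scoped ENNReal Pointwise unitInterval RealInnerProductSpace

noncomputable section

namespace AggGame

/-- The action space `ℝ^T` with the Euclidean norm. -/
abbrev Act (T : ℕ) : Type := EuclideanSpace ℝ (Fin T)

/-- The cube `[0, M + 1]^T`. -/
def cube (T : ℕ) (M : ℝ) : Set (Act T) := {x | ∀ t, 0 ≤ x t ∧ x t ≤ M + 1}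

/-- The subdifferential at `x` of a function `φ` with domain `C`. -/
def subdiff {T : ℕ} (C : Set (Act T)) (φ : Act T → ℝ) (x : Act T) : Set (Act T) :=
  {g | ∀ z ∈ C, φ x + ⟪g, z - x⟫ ≤ φ z}

/-- The relative boundary of `C`: its boundary in the linear span of `C`. -/
def relBoundary {T : ℕ} (C : Set (Act T)) : Set (Act T) :=
  ((↑) : Submodule.span ℝ C → Act T) ''
    frontier (((↑) : Submodule.span ℝ C → Act T) ⁻¹' C)

/-- The set `L²([0,1], C)`. -/
def L2 {T : ℕ} (C : Set (Act T)) : Set (I → Act T) :=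
  {x | MemLp x 2 volume ∧ ∀ᵐ θ, x θ ∈ C}

/-! ### Nonatomic aggregative games -/

/-- A nonatomic aggregative game: the players are the points of `[0,1]` with Lebesgue measure,
player `θ` has the action set `act θ` and the cost `cost θ x Y` of the own action `x` at the
aggregate action `Y`; `dom` is the set on which the costs are considered as functions of the
own action. -/
structure NonatomicGame (T : ℕ) where
  act : I → Set (Act T)
  dom : Set (Act T)
  cost : I → Act T → Act T → ℝ

namespace NonatomicGame

variable {T : ℕ} (G : NonatomicGame T)

/-- The subdifferential `∂₁ f_θ(x, Y)` with respect to the own action. -/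
def subgrad (θ : I) (x Y : Act T) : Set (Act T) := subdiff G.dom (fun z => G.cost θ z Y) x

/-- Feasible pure-action profiles. -/
def profiles : Set (I → Act T) := {x | MemLp x 2 volume ∧ ∀ᵐ θ, x θ ∈ G.act θ}

/-- Feasible aggregate actions. -/
def aggregates : Set (Act T) := {Y | ∃ x ∈ G.profiles, ∫ θ, x θ = Y}

/-- Feasible pure-action profiles whose aggregate satisfies the constraint `A`. -/
def constrProfiles (A : Set (Act T)) : Set (I → Act T) := {x ∈ G.profiles | ∫ θ, x θ ∈ A}

/-- The correspondence `H`: square-integrable selections of subgradients along `x`. -/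
def H (x : I → Act T) : Set (I → Act T) :=
  {g | MemLp g 2 volume ∧ ∀ᵐ θ, g θ ∈ G.subgrad θ (x θ) (∫ ξ, x ξ)}

/-- Variational Wardrop equilibrium under the aggregative constraint `A`. -/
def IsVWE (A : Set (Act T)) (x : I → Act T) : Prop :=
  x ∈ G.constrProfiles A ∧
    ∃ g ∈ G.H x, ∀ y ∈ G.constrProfiles A, 0 ≤ ∫ θ, ⟪g θ, y θ - x θ⟫

/-- Strong monotonicity with modulus `α`. -/
def StronglyMonotone (M α : ℝ) : Prop :=
  ∀ x ∈ L2 (cube T M), ∀ y ∈ L2 (cube T M), ∀ g ∈ G.H x, ∀ h ∈ G.H y,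
    α * ∫ θ, ‖x θ - y θ‖ ^ 2 ≤ ∫ θ, ⟪g θ - h θ, x θ - y θ⟫

/-- Aggregatively strong monotonicity with modulus `β`. -/
def AggStronglyMonotone (M β : ℝ) : Prop :=
  ∀ x ∈ L2 (cube T M), ∀ y ∈ L2 (cube T M), ∀ g ∈ G.H x, ∀ h ∈ G.H y,
    β * ‖(∫ θ, x θ) - ∫ θ, y θ‖ ^ 2 ≤ ∫ θ, ⟪g θ - h θ, x θ - y θ⟫

/-- Nonatomic pure-action sets: nonempty, convex, compact, with nonnegative coordinates, in the
closed ball of radius `M` around `0`, with Borel graph. -/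
structure RegularActions (M : ℝ) : Prop where
  nonempty : ∀ θ, (G.act θ).Nonempty
  convex : ∀ θ, Convex ℝ (G.act θ)
  compact : ∀ θ, IsCompact (G.act θ)
  nonneg : ∀ θ, ∀ x ∈ G.act θ, ∀ t, 0 ≤ x t
  bounded : ∀ θ, G.act θ ⊆ Metric.closedBall 0 M
  graph : MeasurableSet {p : I × Act T | p.2 ∈ G.act p.1}

/-- Nonatomic convex costs, with subgradients bounded by `B`. -/
structure RegularCosts (M B : ℝ) : Prop where
  dom_nhds : G.dom ∈ 𝓝ˢ (cube T M)
  bounded : ∀ θ, ∃ C, ∀ x ∈ cube T M, ∀ Y ∈ cube T M, |G.cost θ x Y| ≤ C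
  measurable : ∀ Y ∈ cube T M, ∀ x ∈ G.dom, AEMeasurable (fun θ => G.cost θ x Y) volume
  continuous : ∀ Y ∈ cube T M, ∀ θ, ContinuousOn (fun x => G.cost θ x Y) G.dom
  convex : ∀ Y ∈ cube T M, ∀ θ, ConvexOn ℝ G.dom (fun x => G.cost θ x Y)
  subgrad_bound : ∀ θ, ∀ x ∈ cube T M, ∀ Y ∈ cube T M, ∀ g ∈ G.subgrad θ x Y, ‖g‖ ≤ B

/-- Continuity of the costs in the aggregate action. -/
def ContinuousInAggregate (M : ℝ) : Prop :=
  ∀ θ, ∀ x ∈ cube T M, ContinuousOn (fun Y => G.cost θ x Y) (cube T M)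

/-- The best-reply correspondence. -/
def bestReply (Y : Act T) : Set (I → Act T) :=
  {x ∈ G.profiles | ∀ θ, x θ ∈ G.act θ ∧ ∀ z ∈ G.act θ, G.cost θ (x θ) Y ≤ G.cost θ z Y}

/-- The subgradients at `x θ` which certify that `x θ` is a best reply to `Y`. -/
def replySubgrad (x : I → Act T) (Y : Act T) (θ : I) : Set (Act T) :=
  {g ∈ G.subgrad θ (x θ) Y | ∀ y ∈ G.act θ, 0 ≤ ⟪g, y - x θ⟫}

/-- For each best reply `x` to a feasible aggregate `Y`, the correspondence `replySubgrad x Y`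
is (Lebesgue) measurable. -/
def MeasurableReplySubgrad : Prop :=
  ∀ Y ∈ G.aggregates, ∀ x ∈ G.bestReply Y, ∀ F : Set (Act T), IsClosed F →
    NullMeasurableSet {θ | (G.replySubgrad x Y θ ∩ F).Nonempty} volume

/-- Some feasible profile stays at a distance larger than `η > 0` from the relative boundaries
of the action sets (the distance to the empty set is infinite). -/
def UniformInterior : Prop :=
  ∃ η : ℝ, 0 < η ∧ ∃ x ∈ G.profiles,
    ∀ᵐ θ, ENNReal.ofReal η < Metric.infEDist (x θ) (relBoundary (G.act θ))

end NonatomicGame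

/-! ### Finite-player aggregative games -/

/-- A finite-player aggregative game: player `i` has the action set `act i` and the cost
`cost i x Y` of the own action `x` at the aggregate action `Y`; `dom i` is the set on which this
cost is considered as a function of the own action. -/
structure FiniteGame (T : ℕ) where
  n : ℕ
  act : Fin n → Set (Act T)
  dom : Fin n → Set (Act T)
  cost : Fin n → Act T → Act T → ℝ

namespace FiniteGame

variable {T : ℕ} (F : FiniteGame T)

/-- The subdifferential `∂₁ f_i(x, Y)` with respect to the own action, at fixed aggregate. -/
def subgrad (i : Fin F.n) (x Y : Act T) : Set (Act T) :=
  subdiff (F.dom i) (fun z => F.cost i z Y) x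

/-- Feasible pure-action profiles. -/
def profiles : Set (Fin F.n → Act T) := {x | ∀ i, x i ∈ F.act i}

/-- Feasible aggregate actions. -/
def aggregates : Set (Act T) := {Y | ∃ x ∈ F.profiles, ∑ i, x i = Y}

/-- Feasible pure-action profiles whose aggregate satisfies the constraint `A`. -/
def constrProfiles (A : Set (Act T)) : Set (Fin F.n → Act T) := {x ∈ F.profiles | ∑ i, x i ∈ A}

/-- Pseudo-variational Nash equilibrium under the aggregative constraint `A`: the subgradients
are those of the costs at fixed aggregate action. -/
def IsPseudoVNE (A : Set (Act T)) (x : Fin F.n → Act T) : Prop :=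
  x ∈ F.constrProfiles A ∧
    ∃ g : Fin F.n → Act T, (∀ i, g i ∈ F.subgrad i (x i) (∑ j, x j)) ∧
      ∀ y ∈ F.constrProfiles A, 0 ≤ ∑ i, ⟪g i, y i - x i⟫

/-- Nonempty, convex and compact action sets, with nonnegative coordinates. -/
structure RegularActions : Prop where
  nonempty : ∀ i, (F.act i).Nonempty
  convex : ∀ i, Convex ℝ (F.act i)
  compact : ∀ i, IsCompact (F.act i)
  nonneg : ∀ i, ∀ x ∈ F.act i, ∀ t, 0 ≤ x t

/-- Convex pseudo-costs: the costs are jointly continuous, and convex in the own action at each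
fixed feasible aggregate action. -/
structure ConvexPseudoCosts : Prop where
  act_subset : ∀ i, F.act i ⊆ F.dom i
  continuous : ∀ i,
    ContinuousOn (fun p : Act T × Act T => F.cost i p.1 p.2) (F.dom i ×ˢ F.aggregates)
  convex : ∀ i, ∀ Y ∈ F.aggregates, ConvexOn ℝ (F.dom i) (fun x => F.cost i x Y)

end FiniteGame

/-! ### Pseudo atomic approximating sequences -/

/-- Measurable sets `Θ_1, …, Θ_n` of positive measure which, together with a null set `Θ_0`,
form a partition of `[0,1]`. -/
structure PlayerPartition (n : ℕ) where
  cell : Fin n → Set I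
  measurable : ∀ i, NullMeasurableSet (cell i) volume
  disjoint : Pairwise fun i j => Disjoint (cell i) (cell j)
  pos : ∀ i, 0 < volume (cell i)
  cover : volume (⋃ i, cell i)ᶜ = 0

namespace PlayerPartition

variable {n : ℕ} (P : PlayerPartition n)

/-- The Lebesgue measure `μ_i` of the cell `Θ_i`. -/
def weight (i : Fin n) : ℝ := volume.real (P.cell i)

/-- The nonatomic profile `ψ(x)`, equal to `x_i / μ_i` on the cell `Θ_i`. -/
def lift {T : ℕ} (x : Fin n → Act T) (θ : I) : Act T :=
  ∑ i, (P.cell i).indicator (fun _ => (P.weight i)⁻¹ • x i) θ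

end PlayerPartition

variable {T : ℕ}

/-- The largest Hausdorff distance between the action set of a nonatomic player and the rescaled
action set of the finite player who represents her. -/
def actionGap (G : NonatomicGame T) (F : FiniteGame T) (P : PlayerPartition F.n) : ℝ≥0∞ :=
  ⨆ i, ⨆ θ ∈ P.cell i, Metric.hausdorffEDist (G.act θ) ((P.weight i)⁻¹ • F.act i)

/-- The largest Hausdorff distance between the subdifferentials of a nonatomic player and those of
the finite player who represents her. -/
def subgradGap (M : ℝ) (G : NonatomicGame T) (F : FiniteGame T) (P : PlayerPartition F.n) :
    ℝ≥0∞ :=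
  ⨆ i, ⨆ θ ∈ P.cell i, ⨆ x ∈ cube T M, ⨆ Y ∈ cube T M,
    Metric.hausdorffEDist (F.subgrad i (P.weight i • x) Y) (G.subgrad θ x Y)

/-- The conditions on a pseudo atomic approximating sequence which do not involve the aggregative
constraints. -/
structure IsPseudoAAS (M : ℝ) (G : NonatomicGame T) (F : ℕ → FiniteGame T)
    (P : ∀ ν, PlayerPartition (F ν).n) : Prop where
  actions : ∀ ν, (F ν).RegularActions
  costs : ∀ ν, (F ν).ConvexPseudoCosts
  dom_nhds : ∀ ν i, (F ν).dom i ∈ 𝓝ˢ ((P ν).weight i • cube T M)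
  span_eq : ∀ ν i, ∀ θ ∈ (P ν).cell i,
    Submodule.span ℝ ((F ν).act i) = Submodule.span ℝ (G.act θ)
  actionGap_tendsto : Tendsto (fun ν => actionGap G (F ν) (P ν)) atTop (𝓝 0)
  subgradGap_tendsto : Tendsto (fun ν => subgradGap M G (F ν) (P ν)) atTop (𝓝 0)

/-- The condition on the aggregative constraint sets of a pseudo atomic approximating sequence. -/
structure ConstraintsConverge (A : Set (Act T)) (A' : ℕ → Set (Act T)) : Prop where
  convex : ∀ ν, Convex ℝ (A' ν)
  compact : ∀ ν, IsCompact (A' ν)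
  span_eq : ∀ ν, Submodule.span ℝ A = Submodule.span ℝ (A' ν)
  tendsto : Tendsto (fun ν => Metric.hausdorffEDist (A' ν) A) atTop (𝓝 0)

/-- The quantity `(3 B + 1) K max(D, δ) + (2 M + 1) d`. -/
def errorTerm (M B K : ℝ) (D δ d : ℝ≥0∞) : ℝ≥0∞ :=
  ENNReal.ofReal ((3 * B + 1) * K) * max D δ + ENNReal.ofReal (2 * M + 1) * d

end AggGame

end

/-! Lift the pseudo-VNE `xh` to the step function `ψ` and compare it with the VWE `xs`. Let `γ i`
and `g` be the subgradients in the two variational inequalities. If `h ∈ H ψ` is a measurable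
selection with `‖h - γ i‖ ≤ d` on the `i`-th cell, monotonicity bounds the squared error, times the
modulus, by `∫ ⟪h - g, ψ - xs⟫`. Let `y` be feasible for the nonatomic game and `c`-close to `ψ`,
and `z` feasible for the finite game and `c`-close to the cell integrals of `xs`. Testing the two
inequalities with `y` and `z` leaves only `B c + (B + d) c + d (2 M + δ)`
(`exists_mem_H_integral_inner_le`).

The selection `h` is a field of nearest points (`exists_aemeasurable_nearest`). It is measurable
because projections of Borel sets are analytic, hence null measurable; subdifferentials have a Borel
graph up to a null set since countably many inequalities define them.

Without aggregative constraints, nearest points and cell averages supply `y` and `z`, with `c` equal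
to the action gap. With constraints, they may miss `A` and `A'` by twice the error. Since the
relative interiors meet, `A - G.aggregates` contains a ball of radius `r` of its span `U`, so mixing
in a further profile with weight of order `e / r` restores feasibility
(`exists_convex_combination_mem`). For the finite game, `UniformInterior` and the span conditions
give `A' - F.aggregates ⊆ U`, and this set inherits a ball of radius `r / 2` by convexity
(`mem_of_ball_subset_of_near`). -/

namespace AggGame

/-! ### Null measurability of analytic sets -/

section Analytic

variable {α : Type*} [TopologicalSpace α] [MeasurableSpace α]

/-- Compactness of the product of the intervals `[0, k i]`: sequences outside `V` obeying ever
longer prefixes of the bounds, truncated by `k`, have a cluster point in the product. Truncation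
eventually changes no given coordinate, so they accumulate there themselves. -/
theorem exists_prefix_subset_of_open {k : ℕ → ℕ} {V : Set (ℕ → ℕ)} (hV : IsOpen V)
    (h : {x : ℕ → ℕ | ∀ i, x i ≤ k i} ⊆ V) : ∃ n, {x : ℕ → ℕ | ∀ i < n, x i ≤ k i} ⊆ V := by
  by_contra! hne
  simp only [Set.not_subset] at hne
  choose x hx hxV using hne
  have hK : IsCompact {x : ℕ → ℕ | ∀ i, x i ≤ k i} := by
    have : {x : ℕ → ℕ | ∀ i, x i ≤ k i} = Set.pi Set.univ fun i => Set.Iic (k i) := by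
      ext
      simp [Pi.le_def]
    rw [this]
    exact isCompact_univ_pi fun i => (Set.finite_Iic (k i)).isCompact
  obtain ⟨a, ha, φ, hφ, hlim⟩ := hK.tendsto_subseq
    (x := fun n i => min (x n i) (k i)) fun n i => min_le_right _ _
  have hlim' : Tendsto (fun n => x (φ n)) atTop (𝓝 a) := by
    rw [tendsto_pi_nhds] at hlim ⊢
    intro i
    refine (hlim i).congr' ?_
    filter_upwards [eventually_gt_atTop i] with n hn
    exact min_eq_left (hx (φ n) i (hn.trans_le (hφ.id_le n)))
  obtain ⟨n, hn⟩ := (hlim'.eventually (hV.mem_nhds (h ha))).exists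
  exact hxV _ hn

/-- Analytic sets are inner regular with respect to compact sets. -/
theorem exists_isCompact_subset_of_lt_measure_range [T2Space α] {μ : Measure α}
    [μ.OuterRegular] {f : (ℕ → ℕ) → α} (hf : Continuous f) {c : ℝ≥0∞}
    (hc : c < μ (Set.range f)) : ∃ L ⊆ Set.range f, IsCompact L ∧ c ≤ μ L := by
  have step : ∀ (n : ℕ) (S : Set (ℕ → ℕ)), ∃ m : ℕ, c < μ (f '' S) →
      c < μ (f '' (S ∩ {x | x n ≤ m})) := by
    intro n S
    by_cases h : c < μ (f '' S)
    -- Continuity from below holds for increasing unions of arbitrary sets, so the images need not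
    -- be measurable.
    · have hmono : Monotone fun m : ℕ => f '' (S ∩ {x | x n ≤ m}) := fun a b hab =>
        Set.image_mono (Set.inter_subset_inter_right _ fun x (hx : x n ≤ a) => hx.trans hab)
      have hU : f '' S = ⋃ m : ℕ, f '' (S ∩ {x | x n ≤ m}) := by
        rw [← Set.image_iUnion, ← Set.inter_iUnion]
        congr 1
        ext x
        simp only [Set.mem_inter_iff, Set.mem_iUnion, Set.mem_ofPred_eq]
        exact ⟨fun hx => ⟨hx, x n, le_rfl⟩, fun hx => hx.1⟩
      rw [hU, hmono.measure_iUnion, lt_iSup_iff] at h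
      obtain ⟨m, hm⟩ := h
      exact ⟨m, fun _ => hm⟩
    · exact ⟨0, fun h' => absurd h' h⟩
  choose m hm using step
  let S : ℕ → Set (ℕ → ℕ) := fun n =>
    Nat.rec Set.univ (fun n S => S ∩ {x | x n ≤ m n S}) n
  have hS : ∀ n, c < μ (f '' S n) := by
    intro n
    induction n with
    | zero => simpa [S] using hc
    | succ n ih => exact hm n _ ih
  have hSn : ∀ n, S n = {x | ∀ i < n, x i ≤ m i (S i)} := by
    intro n
    induction n with
    | zero => simp [S]
    | succ n ih =>
      change S n ∩ {x | x n ≤ m n (S n)} = _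
      ext x
      simp only [Set.mem_inter_iff, Set.mem_ofPred_eq]
      constructor
      · rintro ⟨h1, h2⟩ i hi
        rw [ih] at h1
        rcases Nat.lt_succ_iff_lt_or_eq.1 hi with h | rfl
        · exact h1 i h
        · exact h2
      · intro h
        refine ⟨?_, h n (Nat.lt_succ_self n)⟩
        rw [ih]
        exact fun i hi => h i (hi.trans (Nat.lt_succ_self n))
  set k : ℕ → ℕ := fun i => m i (S i)
  have hK : IsCompact {x : ℕ → ℕ | ∀ i, x i ≤ k i} := by
    have : {x : ℕ → ℕ | ∀ i, x i ≤ k i} = Set.pi Set.univ fun i => Set.Iic (k i) := by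
      ext
      simp [Pi.le_def]
    rw [this]
    exact isCompact_univ_pi fun i => (Set.finite_Iic (k i)).isCompact
  refine ⟨f '' {x : ℕ → ℕ | ∀ i, x i ≤ k i}, Set.image_subset_range _ _, hK.image hf, ?_⟩
  by_contra! hlt
  -- An open `U` of measure below `c` around the compact image would contain the image of some `S
  -- n`, whose measure exceeds `c`.
  obtain ⟨U, hU, hUo, hUc⟩ := Set.exists_isOpen_lt_of_lt _ _ hlt
  obtain ⟨n, hn⟩ := exists_prefix_subset_of_open (hUo.preimage hf) (Set.image_subset_iff.1 hU)
  have h1 : f '' S n ⊆ U := by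
    rw [hSn, Set.image_subset_iff]
    exact hn
  exact absurd ((hS n).trans_le (measure_mono h1)) (not_lt.2 hUc.le)

/-- Analytic sets are universally measurable. -/
theorem nullMeasurableSet_of_analyticSet [BorelSpace α] [T2Space α] {μ : Measure α} [IsFiniteMeasure μ]
    [μ.OuterRegular] {s : Set α} (hs : AnalyticSet s) : NullMeasurableSet s μ := by
  rw [AnalyticSet] at hs
  rcases hs with rfl | ⟨f, hf, rfl⟩
  · exact nullMeasurableSet_empty
  by_cases h0 : μ (Set.range f) = 0
  · exact NullMeasurableSet.of_null h0
  have hlt : ∀ n : ℕ, μ (Set.range f) - ((n : ℝ≥0∞) + 1)⁻¹ < μ (Set.range f) := fun n =>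
    ENNReal.sub_lt_self (measure_ne_top _ _) h0 (by simp)
  choose L hL hLc hLm using fun n => exists_isCompact_subset_of_lt_measure_range hf (hlt n)
  have hmeas : MeasurableSet (⋃ n, L n) := MeasurableSet.iUnion fun n => (hLc n).measurableSet
  refine hmeas.nullMeasurableSet.congr
    (ae_eq_of_subset_of_measure_ge (Set.iUnion_subset hL) ?_ hmeas.nullMeasurableSet
      (measure_ne_top _ _))
  have hlim : Tendsto (fun n : ℕ => μ (Set.range f) - ((n : ℝ≥0∞) + 1)⁻¹) atTop
      (𝓝 (μ (Set.range f) - 0)) := by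
    refine ENNReal.Tendsto.sub tendsto_const_nhds ?_ (Or.inl (measure_ne_top _ _))
    have := (tendsto_add_atTop_iff_nat 1).2 ENNReal.tendsto_inv_nat_nhds_zero
    simpa using this
  rw [tsub_zero] at hlim
  exact le_of_tendsto' hlim fun n => (hLm n).trans (measure_mono (Set.subset_iUnion L n))

end Analytic

/-! ### Measurable selection of nearest points -/

section Selection

variable {Ω E : Type*} [TopologicalSpace Ω] [PolishSpace Ω] [MeasurableSpace Ω] [BorelSpace Ω]
  [NormedAddCommGroup E] [InnerProductSpace ℝ E] [FiniteDimensional ℝ E] [MeasurableSpace E]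
  [BorelSpace E] {μ : Measure Ω} [IsFiniteMeasure μ] [μ.OuterRegular]

theorem nullMeasurableSet_inter_nonempty {S : Ω → Set E}
    (hS : MeasurableSet {p : Ω × E | p.2 ∈ S p.1}) {K : Set E} (hK : MeasurableSet K) :
    NullMeasurableSet {ω | (S ω ∩ K).Nonempty} μ := by
  have : {ω | (S ω ∩ K).Nonempty} =
      Prod.fst '' ({p : Ω × E | p.2 ∈ S p.1} ∩ Prod.snd ⁻¹' K) := by
    ext ω
    simp only [Set.mem_ofPred_eq, Set.mem_image, Set.mem_inter_iff, Set.mem_preimage, Prod.exists,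
      exists_and_right, exists_eq_right]
    rfl
  rw [this]
  have : SecondCountableTopology E := by
    have : ProperSpace E := FiniteDimensional.proper_real E
    infer_instance
  exact nullMeasurableSet_of_analyticSet
    ((hS.inter (measurable_snd hK)).analyticSet_image measurable_fst)

/-- A correspondence with Borel graph and closed convex values has a measurable selection of
nearest points to a given point. -/
theorem exists_aemeasurable_nearest {S : Ω → Set E}
    (hS : MeasurableSet {p : Ω × E | p.2 ∈ S p.1}) (hcl : ∀ ω, IsClosed (S ω))
    (hcv : ∀ ω, Convex ℝ (S ω)) (c : E) :
    ∃ p : Ω → E, AEMeasurable p μ ∧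
      ∀ ω, (S ω).Nonempty → p ω ∈ S ω ∧ ∀ z ∈ S ω, ‖p ω - c‖ ≤ ‖z - c‖ := by
  have : ProperSpace E := FiniteDimensional.proper_real E
  have hex : ∀ ω, ∃ x, ((S ω).Nonempty → x ∈ S ω ∧ ∀ z ∈ S ω, ‖x - c‖ ≤ ‖z - c‖) ∧
      (¬ (S ω).Nonempty → x = c) := by
    intro ω
    by_cases h : (S ω).Nonempty
    · obtain ⟨x, hx, hxc⟩ := (hcl ω).exists_infDist_eq_dist h c
      refine ⟨x, fun _ => ⟨hx, fun z hz => ?_⟩, fun h' => absurd h h'⟩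
      rw [← dist_eq_norm, ← dist_eq_norm, dist_comm, ← hxc, dist_comm z]
      exact Metric.infDist_le_dist_of_mem hz
    · exact ⟨c, fun h' => absurd h' h, fun _ => rfl⟩
  choose p hp hp0 using hex
  -- Nearest points are unique: by the parallelogram law the midpoint of two distinct ones would be
  -- nearer.
  have huniq : ∀ ω, ∀ x ∈ S ω, ‖x - c‖ ≤ ‖p ω - c‖ → x = p ω := by
    intro ω x hx hxp
    obtain ⟨hpS, hmin⟩ := hp ω ⟨x, hx⟩
    have heq : ‖x - c‖ = ‖p ω - c‖ := le_antisymm hxp (hmin x hx)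
    have hmid := hmin _ (hcv ω hx hpS (by norm_num : (0 : ℝ) ≤ 1 / 2)
      (by norm_num : (0 : ℝ) ≤ 1 / 2) (by norm_num))
    have hpar := parallelogram_law_with_norm ℝ (x - c) (p ω - c)
    have h1 : x - c + (p ω - c) = (2 : ℝ) • ((1 / 2 : ℝ) • x + (1 / 2 : ℝ) • p ω - c) := by
      module
    have h2 : x - c - (p ω - c) = x - p ω := by abel
    rw [h1, h2, norm_smul, heq, Real.norm_of_nonneg (by norm_num)] at hpar
    have h0 : ‖x - p ω‖ = 0 := by
      have := norm_nonneg (x - p ω)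
      have := norm_nonneg (p ω - c)
      nlinarith
    exact sub_eq_zero.1 (norm_eq_zero.1 h0)
  refine ⟨p, ?_, hp⟩
  have hm : Measurable (fun ω : NullMeasurableSpace Ω μ => p ω) := by
    refine measurable_of_isClosed fun F hF => ?_
    -- Where `S ω` is nonempty, `p ω ∈ F` means that every rational ball around `c` which meets `S
    -- ω` also meets `S ω ∩ F`: points of `S ω ∩ F` in balls shrinking to radius `‖p ω - c‖`
    -- accumulate at a nearest point. Where `S ω` is empty, `p` has the default value `c`.
    have key : p ⁻¹' F = ({ω | (S ω ∩ Set.univ).Nonempty} ∩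
        ⋂ a : ℚ, {ω | (S ω ∩ Metric.closedBall c a).Nonempty}ᶜ ∪
          {ω | (S ω ∩ (F ∩ Metric.closedBall c a)).Nonempty}) ∪
        ({ω | (S ω ∩ Set.univ).Nonempty}ᶜ ∩ {_ω | c ∈ F}) := by
      ext ω
      by_cases hne : (S ω).Nonempty
      · obtain ⟨hpS, hmin⟩ := hp ω hne
        simp only [Set.mem_preimage, Set.inter_univ, Set.mem_union, Set.mem_inter_iff,
          Set.mem_ofPred_eq, hne, true_and, Set.mem_iInter, Set.mem_compl_iff, not_true, false_and,
          or_false]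
        constructor
        · intro hF a
          by_cases ha : (S ω ∩ Metric.closedBall c a).Nonempty
          · obtain ⟨z, hz, hza⟩ := ha
            refine Or.inr ⟨p ω, hpS, hF, ?_⟩
            rw [mem_closedBall_iff_norm] at hza ⊢
            exact (hmin z hz).trans hza
          · exact Or.inl ha
        · intro h
          have hq : ∀ n : ℕ, ∃ a : ℚ, ‖p ω - c‖ < a ∧ (a : ℝ) < ‖p ω - c‖ + 1 / (n + 1) :=
            fun n => exists_rat_btwn (by linarith [Nat.one_div_pos_of_nat (α := ℝ) (n := n)])
          choose a ha1 ha2 using hq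
          have hz : ∀ n, ∃ z ∈ S ω, z ∈ F ∧ ‖z - c‖ ≤ a n := by
            intro n
            rcases h (a n) with h' | ⟨z, hz, hzF, hza⟩
            · exact absurd ⟨p ω, hpS, mem_closedBall_iff_norm.2 (ha1 n).le⟩ h'
            · exact ⟨z, hz, hzF, mem_closedBall_iff_norm.1 hza⟩
          choose z hzS hzF hza using hz
          obtain ⟨x, -, φ, hφ, hx⟩ := (isCompact_closedBall c (‖p ω - c‖ + 1)).tendsto_subseq
            (x := z) fun n => by
              rw [mem_closedBall_iff_norm]
              refine (hza n).trans ((ha2 n).le.trans ?_)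
              have : (1 : ℝ) / (n + 1) ≤ 1 := by
                rw [div_le_one (by positivity)]
                linarith [(Nat.cast_nonneg n : (0 : ℝ) ≤ n)]
              linarith
          have hxS : x ∈ S ω := (hcl ω).mem_of_tendsto hx (Eventually.of_forall fun n => hzS _)
          have hxF : x ∈ F := hF.mem_of_tendsto hx (Eventually.of_forall fun n => hzF _)
          have hlim : Tendsto (fun n => ‖p ω - c‖ + 1 / ((φ n : ℝ) + 1)) atTop
              (𝓝 (‖p ω - c‖ + 0)) :=
            tendsto_const_nhds.add
              ((tendsto_one_div_add_atTop_nhds_zero_nat (𝕜 := ℝ)).comp hφ.tendsto_atTop)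
          rw [add_zero] at hlim
          have hle : ‖x - c‖ ≤ ‖p ω - c‖ :=
            le_of_tendsto_of_tendsto' (hx.sub_const c).norm hlim fun n =>
              (hza (φ n)).trans (ha2 (φ n)).le
          rwa [← huniq ω x hxS hle]
      · simp [hne, hp0 ω hne]
    change NullMeasurableSet (p ⁻¹' F) μ
    rw [key]
    have hN := fun {K : Set E} (hK : MeasurableSet K) =>
      nullMeasurableSet_inter_nonempty (μ := μ) hS hK
    exact ((hN MeasurableSet.univ).inter (NullMeasurableSet.iInter fun a =>
      (hN Metric.isClosed_closedBall.measurableSet).compl.union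
        (hN (hF.inter Metric.isClosed_closedBall).measurableSet))).union
      ((hN MeasurableSet.univ).compl.inter (NullMeasurableSet.const _))
  have hm' : NullMeasurable p μ := fun s hs => hm hs
  have : SecondCountableTopology E := inferInstance
  exact hm'.aemeasurable

end Selection
end AggGame

/-! ### Measurable subdifferentials and lifted profiles -/

namespace AggGame

variable {T : ℕ}

theorem norm_sub_le_of_infEDist_le {S : Set (Act T)} {c p : Act T} {ε : ℝ}
    (hε : Metric.infEDist c S ≤ ENNReal.ofReal ε) (h0 : 0 ≤ ε)
    (hp : ∀ z ∈ S, ‖p - c‖ ≤ ‖z - c‖) : ‖p - c‖ ≤ ε := by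
  rw [← ENNReal.ofReal_le_ofReal_iff h0]
  refine le_trans ?_ hε
  rw [Metric.le_infEDist]
  intro z hz
  rw [edist_dist, dist_comm, dist_eq_norm]
  exact ENNReal.ofReal_le_ofReal (hp z hz)

theorem nonempty_of_infEDist_le {S : Set (Act T)} {c : Act T} {ε : ℝ}
    (hε : Metric.infEDist c S ≤ ENNReal.ofReal ε) : S.Nonempty := by
  by_contra h
  rw [Set.not_nonempty_iff_eq_empty] at h
  simp [h] at hε

theorem cube_subset_dom {G : NonatomicGame T} {M B : ℝ} (hcost : G.RegularCosts M B) :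
    cube T M ⊆ G.dom := subset_of_mem_nhdsSet hcost.dom_nhds

/-- Along a constant profile, the subdifferential correspondence agrees almost everywhere with a
correspondence with closed convex values and Borel graph. -/
theorem exists_measurable_subgrad {G : NonatomicGame T} {M B : ℝ} (hcost : G.RegularCosts M B)
    {x Y : Act T} (hx : x ∈ cube T M) (hY : Y ∈ cube T M) :
    ∃ S : I → Set (Act T), MeasurableSet {p : I × Act T | p.2 ∈ S p.1} ∧
      (∀ θ, IsClosed (S θ)) ∧ (∀ θ, Convex ℝ (S θ)) ∧ ∀ᵐ θ, S θ = G.subgrad θ x Y := by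
  have hxd := cube_subset_dom hcost hx
  have : Nonempty G.dom := ⟨⟨x, hxd⟩⟩
  let z : ℕ → G.dom := TopologicalSpace.denseSeq G.dom
  have hz : DenseRange z := TopologicalSpace.denseRange_denseSeq G.dom
  have hm := hcost.measurable Y hY
  let f : ℕ → I → ℝ := fun k => (hm (z k) (z k).2).mk
  let fx : I → ℝ := (hm x hxd).mk
  have hf : ∀ k, Measurable (f k) := fun k => (hm (z k) (z k).2).measurable_mk
  have hfx : Measurable fx := (hm x hxd).measurable_mk
  -- The inequalities at a dense sequence suffice by continuity of the costs, and being countably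
  -- many they survive the passage to measurable versions.
  refine ⟨fun θ => {g | ∀ k, fx θ + ⟪g, (z k : Act T) - x⟫ ≤ f k θ}, ?_, ?_, ?_, ?_⟩
  · simp only [Set.mem_ofPred_eq]
    rw [Set.ofPred_forall]
    refine MeasurableSet.iInter fun k => measurableSet_le ?_ ((hf k).comp measurable_fst)
    exact (hfx.comp measurable_fst).add (measurable_snd.inner measurable_const)
  · intro θ
    simp only [Set.ofPred_forall]
    exact isClosed_iInter fun k => isClosed_le (by fun_prop) continuous_const
  · intro θ g hg h hh a b ha hb hab k
    have h1 := mul_le_mul_of_nonneg_left (hg k) ha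
    have h2 := mul_le_mul_of_nonneg_left (hh k) hb
    rw [inner_add_left, real_inner_smul_left, real_inner_smul_left]
    linear_combination h1 + h2 + (f k θ - fx θ) * hab
  · have hae : ∀ᵐ θ, ∀ k, G.cost θ (z k) Y = f k θ :=
      ae_all_iff.2 fun k => (hm (z k) (z k).2).ae_eq_mk
    filter_upwards [hae, (hm x hxd).ae_eq_mk] with θ h1 h2
    ext g
    simp only [NonatomicGame.subgrad, subdiff, Set.mem_ofPred_eq]
    have h2' : G.cost θ x Y = fx θ := h2
    rw [h2']
    constructor
    · intro h w hw
      have hcl : IsClosed {w : G.dom | fx θ + ⟪g, (w : Act T) - x⟫ ≤ G.cost θ w Y} :=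
        isClosed_le (by fun_prop)
          (continuousOn_iff_continuous_domRestrict.1 (hcost.continuous Y hY θ))
      have : {w : G.dom | fx θ + ⟪g, (w : Act T) - x⟫ ≤ G.cost θ w Y} = Set.univ := by
        refine Set.eq_univ_of_univ_subset ?_
        rw [← hz.closure_range]
        refine hcl.closure_subset_iff.2 ?_
        rintro _ ⟨k, rfl⟩
        simp only [Set.mem_ofPred_eq, h1 k]
        exact h k
      have hw' : (⟨w, hw⟩ : G.dom) ∈ {w : G.dom | fx θ + ⟪g, (w : Act T) - x⟫ ≤ G.cost θ w Y} := by
        rw [this]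
        trivial
      exact hw'
    · intro h k
      rw [← h1 k]
      exact h _ (z k).2

namespace PlayerPartition

variable {n : ℕ} (P : PlayerPartition n)

theorem sum_indicator_apply {E : Type*} [AddCommMonoid E] (f : Fin n → I → E) {i : Fin n} {θ : I}
    (hθ : θ ∈ P.cell i) : ∑ j, (P.cell j).indicator (f j) θ = f i θ := by
  rw [Finset.sum_eq_single i]
  · exact Set.indicator_of_mem hθ _
  · intro j _ hj
    exact Set.indicator_of_notMem (fun h => Set.disjoint_left.1 (P.disjoint hj) h hθ) _
  · simp

theorem lift_apply (x : Fin n → Act T) {i : Fin n} {θ : I} (hθ : θ ∈ P.cell i) :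
    P.lift x θ = (P.weight i)⁻¹ • x i :=
  P.sum_indicator_apply (fun i _ => (P.weight i)⁻¹ • x i) hθ

theorem ae_mem_cell : ∀ᵐ θ, ∃ i, θ ∈ P.cell i := by
  rw [ae_iff]
  convert P.cover using 2
  ext θ
  simp

theorem weight_pos (i : Fin n) : 0 < P.weight i :=
  ENNReal.toReal_pos (P.pos i).ne' (measure_ne_top _ _)

theorem aestronglyMeasurable_lift (x : Fin n → Act T) :
    AEStronglyMeasurable (P.lift x) volume := by
  have : P.lift x = ∑ i, (P.cell i).indicator (fun _ => (P.weight i)⁻¹ • x i) := by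
    ext1 θ
    simp [lift]
  rw [this]
  exact Finset.aestronglyMeasurable_sum _ fun i _ =>
    aestronglyMeasurable_const.indicator₀ (P.measurable i)

theorem integral_eq_sum {E : Type*} [NormedAddCommGroup E] [NormedSpace ℝ E]
    {f : I → E} (hf : Integrable f volume) :
    ∫ θ, f θ = ∑ i, ∫ θ in P.cell i, f θ := by
  have h : (volume : Measure I).restrict (⋃ i, P.cell i) = volume :=
    Measure.restrict_eq_self_of_ae_mem (P.ae_mem_cell.mono fun θ hθ => Set.mem_iUnion.2 hθ)
  have h' := integral_iUnion_ae P.measurable (fun i j hij => (P.disjoint hij).aedisjoint)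
    (hf.integrableOn (s := ⋃ i, P.cell i))
  rwa [h, tsum_fintype] at h'

theorem ae_restrict_cell {p : I → Prop} (i : Fin n) (h : ∀ᵐ θ, θ ∈ P.cell i → p θ) :
    ∀ᵐ θ ∂(volume.restrict (P.cell i)), p θ :=
  (ae_restrict_iff'₀ (P.measurable i)).2 h

theorem norm_lift_le {x : Fin n → Act T} {C : ℝ} (hx : ∀ i, ‖x i‖ ≤ P.weight i * C) :
    ∀ᵐ θ, ‖P.lift x θ‖ ≤ C := by
  filter_upwards [P.ae_mem_cell] with θ ⟨i, hi⟩
  rw [P.lift_apply x hi, norm_smul, norm_inv, Real.norm_of_nonneg (P.weight_pos i).le,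
    inv_mul_le_iff₀ (P.weight_pos i)]
  exact hx i

theorem memLp_lift (x : Fin n → Act T) (p : ℝ≥0∞) : MemLp (P.lift x) p volume := by
  refine MemLp.of_bound (P.aestronglyMeasurable_lift x) (∑ i, ‖(P.weight i)⁻¹ • x i‖) ?_
  refine Eventually.of_forall fun θ => (norm_sum_le _ _).trans (Finset.sum_le_sum fun i _ => ?_)
  exact norm_indicator_le_norm_self _ _

theorem setIntegral_lift (x : Fin n → Act T) (i : Fin n) :
    ∫ θ in P.cell i, P.lift x θ = x i := by
  have : ∫ θ in P.cell i, P.lift x θ = ∫ _θ in P.cell i, (P.weight i)⁻¹ • x i :=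
    integral_congr_ae (P.ae_restrict_cell i (Eventually.of_forall fun θ hθ => P.lift_apply x hθ))
  rw [this, integral_const, smul_smul]
  have hw := (P.weight_pos i).ne'
  have : ((volume : Measure I).restrict (P.cell i)).real Set.univ = P.weight i := by
    simp [weight, Measure.real]
  rw [this, mul_inv_cancel₀ hw, one_smul]

theorem integral_lift (x : Fin n → Act T) : ∫ θ, P.lift x θ = ∑ i, x i := by
  rw [P.integral_eq_sum ((P.memLp_lift x 1).integrable le_rfl)]
  exact Finset.sum_congr rfl fun i _ => P.setIntegral_lift x i

/-- Measurable selections of nearest points to constants can be pieced together. -/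
theorem exists_nearest {S : Fin n → I → Set (Act T)}
    (hS : ∀ i, ∃ S' : I → Set (Act T), MeasurableSet {p : I × Act T | p.2 ∈ S' p.1} ∧
      (∀ θ, IsClosed (S' θ)) ∧ (∀ θ, Convex ℝ (S' θ)) ∧ ∀ᵐ θ, S' θ = S i θ)
    (c : Fin n → Act T) :
    ∃ p : I → Act T, AEStronglyMeasurable p volume ∧
      ∀ᵐ θ, ∀ i, θ ∈ P.cell i → (S i θ).Nonempty →
        p θ ∈ S i θ ∧ ∀ z ∈ S i θ, ‖p θ - c i‖ ≤ ‖z - c i‖ := by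
  choose S' hm hcl hcv heq using hS
  choose p hp hpS using fun i =>
    exists_aemeasurable_nearest (μ := (volume : Measure I)) (hm i) (hcl i) (hcv i) (c i)
  refine ⟨fun θ => ∑ i, (P.cell i).indicator (p i) θ, ?_, ?_⟩
  · exact Finset.aestronglyMeasurable_fun_sum _ fun i _ =>
      (hp i).aestronglyMeasurable.indicator₀ (P.measurable i)
  · filter_upwards [ae_all_iff.2 heq] with θ hθ i hi hne
    rw [P.sum_indicator_apply p hi, ← hθ i]
    rw [← hθ i] at hne
    exact hpS i θ hne

end PlayerPartition

end AggGame

/-! ### Approximation of profiles by action sets alone -/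

namespace AggGame

variable {T : ℕ} {M B : ℝ} {G : NonatomicGame T} {F : FiniteGame T} {P : PlayerPartition F.n}
  {A A' : Set (Act T)} {δ d : ℝ}

theorem hausdorffEDist_act_le (h : actionGap G F P ≤ ENNReal.ofReal δ) {i : Fin F.n} {θ : I}
    (hθ : θ ∈ P.cell i) :
    Metric.hausdorffEDist (G.act θ) ((P.weight i)⁻¹ • F.act i) ≤ ENNReal.ofReal δ := by
  simp only [actionGap, iSup_le_iff] at h
  exact h i θ hθ

theorem hausdorffEDist_subgrad_le (h : subgradGap M G F P ≤ ENNReal.ofReal d) {i : Fin F.n} {θ : I}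
    (hθ : θ ∈ P.cell i) {x Y : Act T} (hx : x ∈ cube T M) (hY : Y ∈ cube T M) :
    Metric.hausdorffEDist (F.subgrad i (P.weight i • x) Y) (G.subgrad θ x Y)
      ≤ ENNReal.ofReal d := by
  simp only [subgradGap, iSup_le_iff] at h
  exact h i θ hθ x hx Y hY

theorem infEDist_act_le (h : actionGap G F P ≤ ENNReal.ofReal δ) {i : Fin F.n} {θ : I}
    (hθ : θ ∈ P.cell i) {x : Act T} (hx : x ∈ F.act i) :
    Metric.infEDist ((P.weight i)⁻¹ • x) (G.act θ) ≤ ENNReal.ofReal δ :=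
  (Metric.infEDist_le_hausdorffEDist_of_mem (Set.smul_mem_smul_set hx)).trans
    (by rw [Metric.hausdorffEDist_comm]; exact hausdorffEDist_act_le h hθ)

theorem mem_cube_of_act (hact : G.RegularActions M) {θ : I} {x : Act T} (hx : x ∈ G.act θ) :
    x ∈ cube T M := by
  intro t
  refine ⟨hact.nonneg θ x hx t, ?_⟩
  have h1 := mem_closedBall_zero_iff.1 (hact.bounded θ hx)
  have h2 := PiLp.norm_apply_le x t
  linarith [le_abs_self (x t), Real.norm_eq_abs (x t)]

theorem NonatomicGame.profiles_subset_L2 (hact : G.RegularActions M) {x : I → Act T}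
    (hx : x ∈ G.profiles) : x ∈ L2 (cube T M) :=
  ⟨hx.1, hx.2.mono fun _ h => mem_cube_of_act hact h⟩

theorem norm_le_of_act (hact : G.RegularActions M) {θ : I} {x : Act T} (hx : x ∈ G.act θ) :
    ‖x‖ ≤ M := mem_closedBall_zero_iff.1 (hact.bounded θ hx)

/-- A cell has positive measure, hence contains some `θ`; the rescaled action is within `δ` of
`G.act θ`, which lies in the ball of radius `M`. -/
theorem norm_finite_act_le (hact : G.RegularActions M) (hδ : 0 ≤ δ)
    (h : actionGap G F P ≤ ENNReal.ofReal δ) {i : Fin F.n} {x : Act T} (hx : x ∈ F.act i) :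
    ‖x‖ ≤ P.weight i * (M + δ) := by
  obtain ⟨θ, hθ⟩ := nonempty_of_measure_ne_zero (P.pos i).ne'
  have h1 := infEDist_act_le h hθ hx
  obtain ⟨z, hz, hzd⟩ := (hact.compact θ).exists_infEDist_eq_edist (hact.nonempty θ)
    ((P.weight i)⁻¹ • x)
  rw [hzd, edist_dist, ENNReal.ofReal_le_ofReal_iff hδ, dist_eq_norm] at h1
  have h2 : ‖(P.weight i)⁻¹ • x‖ ≤ M + δ := by
    have := norm_add_le ((P.weight i)⁻¹ • x - z) z
    rw [sub_add_cancel] at this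
    linarith [norm_le_of_act hact hz]
  rwa [norm_smul, norm_inv, Real.norm_of_nonneg (P.weight_pos i).le,
    inv_mul_le_iff₀ (P.weight_pos i)] at h2

/-- Here `δ ≤ 1` meets the margin in the cube `[0, M + 1]^T`, so that monotonicity and the
subgradient bounds apply along the lift. -/
theorem lift_mem_cube (hact : G.RegularActions M) (hF : F.RegularActions) (hδ : 0 ≤ δ)
    (hδ1 : δ ≤ 1) (h : actionGap G F P ≤ ENNReal.ofReal δ) {x : Fin F.n → Act T}
    (hx : x ∈ F.profiles) : P.lift x ∈ L2 (cube T M) := by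
  refine ⟨P.memLp_lift x 2, ?_⟩
  filter_upwards [P.ae_mem_cell, P.norm_lift_le fun i => norm_finite_act_le hact hδ h (hx i)]
    with θ ⟨i, hi⟩ hn t
  constructor
  · rw [P.lift_apply x hi]
    exact mul_nonneg (inv_nonneg.2 (P.weight_pos i).le) (hF.nonneg i _ (hx i) t)
  · have h2 := PiLp.norm_apply_le (P.lift x θ) t
    linarith [le_abs_self (P.lift x θ t), Real.norm_eq_abs (P.lift x θ t)]

theorem integral_mem_cube {x : I → Act T} (hx : x ∈ L2 (cube T M)) :
    ∫ θ, x θ ∈ cube T M := by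
  have hcl : IsClosed (cube T M) := by
    have : cube T M = ⋂ t, ({x : Act T | 0 ≤ x t} ∩ {x : Act T | x t ≤ M + 1}) := by
      ext
      simp [cube]
    rw [this]
    exact isClosed_iInter fun t => (isClosed_le continuous_const (by fun_prop)).inter
      (isClosed_le (by fun_prop) continuous_const)
  have hcv : Convex ℝ (cube T M) := by
    intro x hx y hy a b ha hb hab t
    have h1 := hx t
    have h2 := hy t
    simp only [PiLp.add_apply, PiLp.smul_apply, smul_eq_mul]
    constructor
    · exact add_nonneg (mul_nonneg ha h1.1) (mul_nonneg hb h2.1)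
    · have h3 := mul_le_mul_of_nonneg_left h1.2 ha
      have h4 := mul_le_mul_of_nonneg_left h2.2 hb
      linear_combination h3 + h4 + (M + 1) * hab
  exact hcv.integral_mem hcl hx.2 (hx.1.integrable (by norm_num))

/-- A profile of the finite game is close to a profile of the nonatomic game. -/
theorem exists_profile_near_lift (hact : G.RegularActions M) (hδ : 0 ≤ δ)
    (h : actionGap G F P ≤ ENNReal.ofReal δ) {x : Fin F.n → Act T} (hx : x ∈ F.profiles) :
    ∃ y ∈ G.profiles, ∀ᵐ θ, ‖y θ - P.lift x θ‖ ≤ δ := by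
  obtain ⟨y, hym, hy⟩ := P.exists_nearest (S := fun _ θ => G.act θ)
    (fun i => ⟨G.act, hact.graph, fun θ => (hact.compact θ).isClosed, hact.convex,
      Eventually.of_forall fun _ => rfl⟩) fun i => (P.weight i)⁻¹ • x i
  have hmem : ∀ᵐ θ, y θ ∈ G.act θ := by
    filter_upwards [hy, P.ae_mem_cell] with θ hθ ⟨i, hi⟩
    exact (hθ i hi (hact.nonempty θ)).1
  refine ⟨y, ⟨MemLp.of_bound hym M (hmem.mono fun θ h => norm_le_of_act hact h), hmem⟩, ?_⟩
  filter_upwards [hy, P.ae_mem_cell] with θ hθ ⟨i, hi⟩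
  rw [P.lift_apply x hi]
  exact norm_sub_le_of_infEDist_le (infEDist_act_le h hi (hx i)) hδ
    (hθ i hi (hact.nonempty θ)).2

/-- A profile of the nonatomic game is close to a profile of the finite game. -/
theorem exists_finite_profile_near (hF : F.RegularActions) (hδ : 0 ≤ δ)
    (h : actionGap G F P ≤ ENNReal.ofReal δ) {x : I → Act T} (hx : x ∈ G.profiles) :
    ∃ y ∈ F.profiles, ∀ i, ‖y i - ∫ θ in P.cell i, x θ‖ ≤ P.weight i * δ := by
  have hex : ∀ i, ∃ y ∈ F.act i, ‖y - ∫ θ in P.cell i, x θ‖ ≤ P.weight i * δ := by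
    intro i
    have hw := P.weight_pos i
    set C : Set (Act T) := (P.weight i)⁻¹ • F.act i with hC
    have hCc : IsCompact C := (hF.compact i).smul _
    -- On the cell, `x` takes values a.e. in the closed convex `δ`-thickening of the rescaled action
    -- set, so its average stays there.
    have hav : (⨍ θ in P.cell i, x θ) ∈ Metric.cthickening δ C := by
      refine (((hF.convex i).smul _).cthickening δ).set_average_mem Metric.isClosed_cthickening
        (P.pos i).ne' (measure_ne_top _ _) (P.ae_restrict_cell i ?_)
        (hx.1.integrable (by norm_num)).integrableOn
      filter_upwards [hx.2] with θ hθ hi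
      exact (Metric.infEDist_le_hausdorffEDist_of_mem hθ).trans (hausdorffEDist_act_le h hi)
    obtain ⟨z, hz, hzd⟩ := hCc.exists_infEDist_eq_edist ((hF.nonempty i).smul_set)
      (⨍ θ in P.cell i, x θ)
    rw [Metric.mem_cthickening_iff, hzd, edist_dist, ENNReal.ofReal_le_ofReal_iff hδ,
      dist_comm, dist_eq_norm] at hav
    obtain ⟨y, hy, rfl⟩ := hz
    refine ⟨y, hy, ?_⟩
    have : y - ∫ θ in P.cell i, x θ =
        P.weight i • ((P.weight i)⁻¹ • y - ⨍ θ in P.cell i, x θ) := by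
      rw [setAverage_eq, smul_sub, smul_smul, smul_smul]
      change _ = _ - (P.weight i * (P.weight i)⁻¹) • _
      rw [mul_inv_cancel₀ hw.ne', one_smul, one_smul]
    rw [this, norm_smul, Real.norm_of_nonneg hw.le]
    exact mul_le_mul_of_nonneg_left hav hw.le
  choose y hy hyd using hex
  exact ⟨y, hy, hyd⟩

theorem PlayerPartition.sum_weight {n : ℕ} (P : PlayerPartition n) : ∑ i, P.weight i = 1 := by
  have := P.integral_eq_sum (f := fun _ : I => (1 : ℝ)) (integrable_const _)
  simp only [integral_const, smul_eq_mul, mul_one] at this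
  simp only [PlayerPartition.weight]
  simpa using this.symm

theorem norm_sum_sub_integral_le {n : ℕ} (P : PlayerPartition n) {y : Fin n → Act T}
    {x : I → Act T} (hx : Integrable x volume) {c : ℝ}
    (h : ∀ i, ‖y i - ∫ θ in P.cell i, x θ‖ ≤ P.weight i * c) :
    ‖∑ i, y i - ∫ θ, x θ‖ ≤ c := by
  rw [P.integral_eq_sum hx, ← Finset.sum_sub_distrib]
  refine (norm_sum_le _ _).trans ((Finset.sum_le_sum fun i _ => h i).trans ?_)
  rw [← Finset.sum_mul, P.sum_weight, one_mul]

theorem norm_integral_sub_le {x y : I → Act T} (hx : Integrable x volume)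
    (hy : Integrable y volume) {c : ℝ} (h : ∀ᵐ θ, ‖x θ - y θ‖ ≤ c) :
    ‖(∫ θ, x θ) - ∫ θ, y θ‖ ≤ c := by
  rw [← integral_sub hx hy]
  simpa using norm_integral_le_of_norm_le_const h

end AggGame

/-! ### Stability estimate for the variational inequalities -/

namespace AggGame

variable {T : ℕ} {M B : ℝ} {G : NonatomicGame T} {F : FiniteGame T} {P : PlayerPartition F.n}
  {A A' : Set (Act T)} {δ d : ℝ}

theorem integrable_inner_of_memLp_two {f g : I → Act T} (hf : MemLp f 2 volume)
    (hg : MemLp g 2 volume) : Integrable (fun θ => ⟪f θ, g θ⟫) volume := by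
  refine (hf.norm.integrable_mul hg.norm).mono (hf.1.inner hg.1) (Eventually.of_forall fun θ => ?_)
  simpa using norm_inner_le_norm (𝕜 := ℝ) (f θ) (g θ)

/-- The lift is constant on a cell of positive measure, so its a.e. membership in the cube passes to
the value itself. -/
theorem inv_smul_mem_cube (hact : G.RegularActions M) (hF : F.RegularActions) (hδ : 0 ≤ δ)
    (hδ1 : δ ≤ 1) (h : actionGap G F P ≤ ENNReal.ofReal δ) {x : Fin F.n → Act T}
    (hx : x ∈ F.profiles) (i : Fin F.n) : (P.weight i)⁻¹ • x i ∈ cube T M := by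
  have : NeBot (ae (volume.restrict (P.cell i))) := ae_restrict_neBot.2 (P.pos i).ne'
  obtain ⟨θ, hθ⟩ := (P.ae_restrict_cell i
    ((lift_mem_cube hact hF hδ hδ1 h hx).2.mono fun θ hθ hi =>
      show (P.weight i)⁻¹ • x i ∈ cube T M by rwa [P.lift_apply x hi] at hθ)).exists
  exact hθ

/-- Near the subgradients of the finite players there is a selection of subgradients of the
nonatomic players along the lifted profile. -/
theorem exists_mem_H_lift (hact : G.RegularActions M) (hcost : G.RegularCosts M B)
    (hF : F.RegularActions) (hδ : 0 ≤ δ) (hδ1 : δ ≤ 1) (hd : 0 ≤ d)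
    (hact' : actionGap G F P ≤ ENNReal.ofReal δ) (hsub : subgradGap M G F P ≤ ENNReal.ofReal d)
    {x : Fin F.n → Act T} (hx : x ∈ F.profiles) {γ : Fin F.n → Act T}
    (hγ : ∀ i, γ i ∈ F.subgrad i (x i) (∑ j, x j)) :
    ∃ h ∈ G.H (P.lift x), (∀ i, ‖γ i‖ ≤ B + d) ∧
      ∀ᵐ θ, ∀ i, θ ∈ P.cell i → ‖h θ - γ i‖ ≤ d := by
  have hψ := lift_mem_cube hact hF hδ hδ1 hact' hx
  have hY : ∑ j, x j ∈ cube T M := by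
    rw [← P.integral_lift]
    exact integral_mem_cube hψ
  have hc := inv_smul_mem_cube hact hF hδ hδ1 hact' hx
  obtain ⟨h, hm, hh⟩ := P.exists_nearest
    (S := fun i θ => G.subgrad θ ((P.weight i)⁻¹ • x i) (∑ j, x j))
    (fun i => exists_measurable_subgrad hcost (hc i) hY) γ
  have hinf : ∀ i, ∀ θ ∈ P.cell i, Metric.infEDist (γ i)
      (G.subgrad θ ((P.weight i)⁻¹ • x i) (∑ j, x j)) ≤ ENNReal.ofReal d := by
    intro i θ hi
    refine (Metric.infEDist_le_hausdorffEDist_of_mem ?_).trans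
      (hausdorffEDist_subgrad_le hsub hi (hc i) hY)
    rw [smul_smul, mul_inv_cancel₀ (P.weight_pos i).ne', one_smul]
    exact hγ i
  have hcell : ∀ᵐ θ, ∀ i, θ ∈ P.cell i →
      h θ ∈ G.subgrad θ ((P.weight i)⁻¹ • x i) (∑ j, x j) ∧ ‖h θ - γ i‖ ≤ d := by
    filter_upwards [hh] with θ hθ i hi
    obtain ⟨h1, h2⟩ := hθ i hi (nonempty_of_infEDist_le (hinf i θ hi))
    exact ⟨h1, norm_sub_le_of_infEDist_le (hinf i θ hi) hd h2⟩
  refine ⟨h, ⟨MemLp.of_bound hm B ?_, ?_⟩, fun i => ?_, hcell.mono fun θ hθ i hi => (hθ i hi).2⟩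
  · filter_upwards [hcell, P.ae_mem_cell] with θ hθ ⟨i, hi⟩
    exact hcost.subgrad_bound θ _ (hc i) _ hY _ (hθ i hi).1
  · filter_upwards [hcell, P.ae_mem_cell] with θ hθ ⟨i, hi⟩
    rw [P.integral_lift, P.lift_apply x hi]
    exact (hθ i hi).1
  · have : NeBot (ae (volume.restrict (P.cell i))) := ae_restrict_neBot.2 (P.pos i).ne'
    obtain ⟨θ, h1, h2⟩ := (P.ae_restrict_cell i (hcell.mono fun θ hθ hi => hθ i hi)).exists
    have h3 := hcost.subgrad_bound θ _ (hc i) _ hY _ h1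
    have h4 := norm_sub_le (h θ) (h θ - γ i)
    rw [sub_sub_cancel] at h4
    linarith

/-- Stability estimate: the equilibria of the two games almost satisfy each other's variational
inequality. -/
theorem exists_mem_H_integral_inner_le (hB : 0 < B) (hact : G.RegularActions M)
    (hcost : G.RegularCosts M B) (hF : F.RegularActions) (hδ : 0 ≤ δ) (hδ1 : δ ≤ 1) (hd : 0 ≤ d)
    (hact' : actionGap G F P ≤ ENNReal.ofReal δ) (hsub : subgradGap M G F P ≤ ENNReal.ofReal d)
    {xs g : I → Act T} (hxs : xs ∈ G.profiles) (hg : g ∈ G.H xs)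
    (hVI : ∀ y ∈ G.constrProfiles A, 0 ≤ ∫ θ, ⟪g θ, y θ - xs θ⟫)
    {xh : Fin F.n → Act T} (hxh : F.IsPseudoVNE A' xh) {c : ℝ}
    {y : I → Act T} (hy : y ∈ G.constrProfiles A) (hyc : ∀ᵐ θ, ‖y θ - P.lift xh θ‖ ≤ c)
    {z : Fin F.n → Act T} (hz : z ∈ F.constrProfiles A')
    (hzc : ∀ i, ‖z i - ∫ θ in P.cell i, xs θ‖ ≤ P.weight i * c) :
    ∃ h ∈ G.H (P.lift xh),
      ∫ θ, ⟪h θ - g θ, P.lift xh θ - xs θ⟫ ≤ B * c + (B + d) * c + d * (2 * M + δ) := by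
  obtain ⟨hxh, γ, hγ, hγVI⟩ := hxh
  obtain ⟨h, hh, hγB, hhγ⟩ := exists_mem_H_lift hact hcost hF hδ hδ1 hd hact' hsub hxh.1 hγ
  refine ⟨h, hh, ?_⟩
  set ψ := P.lift xh with hψ
  have hψL : MemLp ψ 2 volume := P.memLp_lift xh 2
  -- The factor `P.weight i` cancels the rescaling in `lift`: `Γ` has the value `γ i` on the cell.
  let Γ : I → Act T := P.lift fun i => P.weight i • γ i
  have hΓ : ∀ {i θ}, θ ∈ P.cell i → Γ θ = γ i := fun {i θ} hi => by
    simp only [Γ]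
    rw [P.lift_apply _ hi, smul_smul, inv_mul_cancel₀ (P.weight_pos i).ne', one_smul]
  have hΓL : MemLp Γ 2 volume := P.memLp_lift _ 2
  have hxsc := NonatomicGame.profiles_subset_L2 hact hxs
  have hXs : ∫ θ, xs θ ∈ cube T M := integral_mem_cube hxsc
  have hgB : ∀ᵐ θ, ‖g θ‖ ≤ B := by
    filter_upwards [hg.2, hxsc.2] with θ h1 h2
    exact hcost.subgrad_bound θ _ h2 _ hXs _ h1
  have hi1 : Integrable (fun θ => ⟪h θ - g θ, ψ θ - xs θ⟫) volume :=
    integrable_inner_of_memLp_two (hh.1.sub hg.1) (hψL.sub hxs.1)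
  have hi2 : Integrable (fun θ => ⟪Γ θ, ψ θ - xs θ⟫) volume :=
    integrable_inner_of_memLp_two hΓL (hψL.sub hxs.1)
  have hi3 : Integrable (fun θ => ⟪g θ, y θ - xs θ⟫) volume :=
    integrable_inner_of_memLp_two hg.1 (hy.1.1.sub hxs.1)
  have hi4 : Integrable (fun θ => ⟪Γ θ, ψ θ - xs θ⟫ - ⟪g θ, y θ - xs θ⟫) volume := hi2.sub hi3
  have hle : ∫ θ, ⟪h θ - g θ, ψ θ - xs θ⟫ ≤
      ∫ θ, ((⟪Γ θ, ψ θ - xs θ⟫ - ⟪g θ, y θ - xs θ⟫) + (d * (2 * M + δ) + B * c)) := by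
    refine integral_mono_ae hi1 (hi4.add (integrable_const _)) ?_
    filter_upwards [hhγ, P.ae_mem_cell, hgB, hyc, hxs.2,
      P.norm_lift_le fun i => norm_finite_act_le hact hδ hact' (hxh.1 i)]
      with θ h1 ⟨i, hi⟩ h2 h3 h4 h5
    -- Replace `h` by `Γ` at cost `d (2 M + δ)`, and `ψ` by the admissible test profile `y` at cost
    -- `B c`.
    have e1 : ⟪h θ - g θ, ψ θ - xs θ⟫ = ⟪Γ θ, ψ θ - xs θ⟫ - ⟪g θ, y θ - xs θ⟫ +
        (⟪h θ - Γ θ, ψ θ - xs θ⟫ + ⟪g θ, y θ - ψ θ⟫) := by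
      simp only [inner_sub_left, inner_sub_right]
      ring
    have e2 : ⟪h θ - Γ θ, ψ θ - xs θ⟫ ≤ d * (2 * M + δ) := by
      refine (real_inner_le_norm _ _).trans (mul_le_mul ?_ ?_ (norm_nonneg _) hd)
      · rw [hΓ hi]
        exact h1 i hi
      · linarith [norm_sub_le (ψ θ) (xs θ), norm_le_of_act hact h4]
    have e3 : ⟪g θ, y θ - ψ θ⟫ ≤ B * c :=
      (real_inner_le_norm _ _).trans (mul_le_mul h2 h3 (norm_nonneg _) hB.le)
    linarith
  rw [integral_add hi4 (integrable_const _), integral_sub hi2 hi3] at hle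
  have hconst : ∫ _θ : I, (d * (2 * M + δ) + B * c) = d * (2 * M + δ) + B * c := by simp
  rw [hconst] at hle
  -- Since `Γ` is constant on cells, only the cell integrals of `xs` enter, and those are what `z`
  -- approximates.
  have hsum : ∫ θ, ⟪Γ θ, ψ θ - xs θ⟫ = ∑ i, ⟪γ i, xh i - ∫ θ in P.cell i, xs θ⟫ := by
    rw [P.integral_eq_sum hi2]
    refine Finset.sum_congr rfl fun i _ => ?_
    have hψi := ((hψL.integrable (by norm_num)).integrableOn (s := P.cell i))
    have hxi := ((hxs.1.integrable (by norm_num)).integrableOn (s := P.cell i))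
    have hψx : Integrable (fun θ => ψ θ - xs θ) (volume.restrict (P.cell i)) := hψi.sub hxi
    rw [integral_congr_ae (g := fun θ => ⟪γ i, ψ θ - xs θ⟫) (P.ae_restrict_cell i
      (Eventually.of_forall fun θ hi => by rw [hΓ hi])), integral_inner hψx,
      integral_sub hψi hxi, P.setIntegral_lift]
  have hsum' : ∑ i, ⟪γ i, xh i - ∫ θ in P.cell i, xs θ⟫ ≤ (B + d) * c := by
    have e1 : ∑ i, ⟪γ i, xh i - ∫ θ in P.cell i, xs θ⟫ =
        ∑ i, ⟪γ i, z i - ∫ θ in P.cell i, xs θ⟫ - ∑ i, ⟪γ i, z i - xh i⟫ := by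
      rw [← Finset.sum_sub_distrib]
      refine Finset.sum_congr rfl fun i _ => ?_
      simp only [inner_sub_right]
      ring
    have e2 : ∑ i, ⟪γ i, z i - ∫ θ in P.cell i, xs θ⟫ ≤ ∑ i, P.weight i * ((B + d) * c) := by
      refine Finset.sum_le_sum fun i _ => (real_inner_le_norm _ _).trans ?_
      refine (mul_le_mul (hγB i) (hzc i) (norm_nonneg _) (by positivity)).trans_eq ?_
      ring
    rw [← Finset.sum_mul, P.sum_weight, one_mul] at e2
    linarith [hγVI z hz]
  linarith [hVI y hy]

end AggGame

/-! ### Convex geometry of the difference set `A - C` -/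

namespace AggGame

/-- Otherwise `interior t` and the complement of `closure t` would separate `s`. -/
theorem inter_frontier_nonempty_of_isPreconnected {α : Type*} [TopologicalSpace α] {s t : Set α}
    (hs : IsPreconnected s) (h₁ : (s ∩ t).Nonempty) (h₂ : (s ∩ tᶜ).Nonempty) :
    (s ∩ frontier t).Nonempty := by
  by_contra hne
  rw [Set.not_nonempty_iff_eq_empty, ← Set.disjoint_iff_inter_eq_empty, Set.disjoint_left] at hne
  have hint : ∀ x ∈ s, x ∈ t → x ∈ interior t := fun x hx hxt => by
    by_contra h
    exact hne hx ⟨subset_closure hxt, h⟩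
  have hext : ∀ x ∈ s, x ∉ t → x ∈ (closure t)ᶜ := fun x hx hxt h =>
    hne hx ⟨h, fun h' => hxt (interior_subset h')⟩
  obtain ⟨a, ha, hat⟩ := h₁
  obtain ⟨b, hb, hbt⟩ := h₂
  obtain ⟨q, -, hq1, hq2⟩ := hs (interior t) (closure t)ᶜ isOpen_interior
    isClosed_closure.isOpen_compl
    (fun x hx => (em (x ∈ t)).imp (hint x hx) (hext x hx)) ⟨a, ha, hint a ha hat⟩
    ⟨b, hb, hext b hb hbt⟩
  exact hq2 (subset_closure (interior_subset hq1))

section Convex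

variable {E : Type*} [NormedAddCommGroup E] [InnerProductSpace ℝ E]

/-- The addition map from `V × W` onto `V ⊔ W` has a linear right inverse, bounded because the
dimension is finite. -/
theorem exists_bounded_decomposition [FiniteDimensional ℝ E] (V W : Submodule ℝ E) :
    ∃ C > 0, ∀ u ∈ V ⊔ W, ∃ v ∈ V, ∃ w ∈ W, u = v + w ∧ ‖v‖ ≤ C * ‖u‖ ∧ ‖w‖ ≤ C * ‖u‖ := by
  rw [Submodule.sup_eq_range]
  set L := V.subtype.coprod W.subtype
  obtain ⟨R, hR⟩ := L.rangeRestrict.exists_rightInverse_of_surjective L.range_rangeRestrict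
  let R' := LinearMap.toContinuousLinearMap R
  refine ⟨‖R'‖ + 1, by positivity, fun u hu => ?_⟩
  have h1 : ‖R ⟨u, hu⟩‖ ≤ (‖R'‖ + 1) * ‖u‖ := by
    have h2 : ‖R ⟨u, hu⟩‖ ≤ ‖R'‖ * ‖u‖ := R'.le_opNorm ⟨u, hu⟩
    linarith [norm_nonneg u]
  have h3 : u = L (R ⟨u, hu⟩) :=
    (congrArg Subtype.val (LinearMap.congr_fun hR ⟨u, hu⟩)).symm
  refine ⟨(R ⟨u, hu⟩).1, (R ⟨u, hu⟩).1.2, (R ⟨u, hu⟩).2, (R ⟨u, hu⟩).2.2, h3,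
    le_trans ?_ h1, le_trans ?_ h1⟩
  · exact norm_fst_le (R ⟨u, hu⟩)
  · exact norm_snd_le (R ⟨u, hu⟩)

theorem exists_ball_of_mem_intrinsicInterior {A : Set E} {z : E}
    (hz : z ∈ intrinsicInterior ℝ A) :
    ∃ r > 0, ∀ v ∈ vectorSpan ℝ A, ‖v‖ ≤ r → z + v ∈ A := by
  obtain ⟨y, hy, rfl⟩ := mem_intrinsicInterior.1 hz
  obtain ⟨ε, hε, hball⟩ := Metric.isOpen_iff.1 isOpen_interior y hy
  refine ⟨ε / 2, by positivity, fun v hv hvn => ?_⟩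
  have hmem : (y : E) + v ∈ affineSpan ℝ A := by
    rw [add_comm, ← vadd_eq_add]
    exact AffineSubspace.vadd_mem_of_mem_direction (by rwa [direction_affineSpan]) y.2
  have : (⟨(y : E) + v, hmem⟩ : affineSpan ℝ A) ∈ Metric.ball y ε := by
    rw [Metric.mem_ball, Subtype.dist_eq, dist_eq_norm, add_sub_cancel_left]
    linarith
  exact (interior_subset (hball this) : _ ∈ Subtype.val ⁻¹' A)

/-- If the relative interiors of two sets meet, their difference is a neighbourhood of `0` in its
linear span. -/
theorem exists_ball_subset_sub [FiniteDimensional ℝ E] {A C : Set E}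
    (h : (intrinsicInterior ℝ A ∩ intrinsicInterior ℝ C).Nonempty) :
    ∃ r > 0, ∀ u ∈ Submodule.span ℝ (A - C), ‖u‖ ≤ r → u ∈ A - C := by
  obtain ⟨z, hzA, hzC⟩ := h
  obtain ⟨r₁, hr₁, h₁⟩ := exists_ball_of_mem_intrinsicInterior hzA
  obtain ⟨r₂, hr₂, h₂⟩ := exists_ball_of_mem_intrinsicInterior hzC
  obtain ⟨K, hK, hdec⟩ := exists_bounded_decomposition (vectorSpan ℝ A) (vectorSpan ℝ C)
  refine ⟨min r₁ r₂ / K, by positivity, fun u hu hur => ?_⟩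
  have hle : Submodule.span ℝ (A - C) ≤ vectorSpan ℝ A ⊔ vectorSpan ℝ C := by
    rw [Submodule.span_le]
    rintro _ ⟨a, ha, c, hc, rfl⟩
    -- Passing through the common point `z` splits a difference into directions of `A` and of `C`.
    have : a - c = (a - z) - (c - z) := by abel
    simp only [this]
    exact Submodule.sub_mem _
      (Submodule.mem_sup_left (vsub_mem_vectorSpan ℝ ha (intrinsicInterior_subset hzA)))
      (Submodule.mem_sup_right (vsub_mem_vectorSpan ℝ hc (intrinsicInterior_subset hzC)))
  obtain ⟨v, hv, w, hw, rfl, hvn, hwn⟩ := hdec u (hle hu)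
  rw [le_div_iff₀ hK, mul_comm] at hur
  refine ⟨z + v, h₁ v hv (hvn.trans (hur.trans (min_le_left _ _))), z + -w,
    h₂ (-w) (Submodule.neg_mem _ hw) ?_, ?_⟩
  swap
  · change z + v - (z + -w) = v + w
    abel
  rw [norm_neg]
  exact hwn.trans (hur.trans (min_le_right _ _))

/-- A compact convex set which approximates a set containing a ball contains a smaller ball. -/
theorem mem_of_ball_subset_of_near {K K' : Set E} {U : Submodule ℝ E} (hc : Convex ℝ K')
    (hK' : IsCompact K') (hU : K' ⊆ U) {r ε : ℝ} (hr : 0 < r)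
    (hball : ∀ u ∈ U, ‖u‖ ≤ r → u ∈ K) (hnear : ∀ k ∈ K, ∃ k' ∈ K', ‖k - k'‖ ≤ ε)
    {u : E} (hu : u ∈ U) (hur : ‖u‖ ≤ r - ε) : u ∈ K' := by
  obtain ⟨k₀, hk₀, -⟩ := hnear 0 (hball 0 U.zero_mem (by simpa using hr.le))
  -- Let `p` be the projection of `u` onto `K'`. If `u ≠ p`, put `n = (u - p) / ‖u - p‖`. As `r • n
  -- ∈ K`, some `k' ∈ K'` has `⟪n, k'⟫ ≥ r - ε ≥ ⟪n, u⟫ > ⟪n, p⟫`, against the projection inequality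
  -- `⟪n, k' - p⟫ ≤ 0`.
  obtain ⟨p, hp, hpn⟩ := exists_norm_eq_iInf_of_complete_convex ⟨k₀, hk₀⟩ hK'.isComplete hc u
  rw [norm_eq_iInf_iff_real_inner_le_zero hc hp] at hpn
  by_cases hup : u - p = 0
  · rwa [sub_eq_zero.1 hup]
  exfalso
  have hn : 0 < ‖u - p‖ := norm_pos_iff.2 hup
  obtain ⟨k', hk', hkk⟩ := hnear ((r / ‖u - p‖) • (u - p)) (hball _
    (U.smul_mem _ (U.sub_mem hu (hU hp))) (by
      rw [norm_smul, Real.norm_of_nonneg (by positivity), div_mul_cancel₀ _ hn.ne']))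
  have h1 := hpn k' hk'
  have h2 : ⟪u - p, k' - p⟫ = ⟪u - p, (r / ‖u - p‖) • (u - p)⟫
      - ⟪u - p, (r / ‖u - p‖) • (u - p) - k'⟫ - ⟪u - p, u⟫ + ⟪u - p, u - p⟫ := by
    simp only [inner_sub_right]
    ring
  have h3 : ⟪u - p, (r / ‖u - p‖) • (u - p)⟫ = r * ‖u - p‖ := by
    rw [real_inner_smul_right, real_inner_self_eq_norm_sq]
    field_simp
  have h4 : ⟪u - p, (r / ‖u - p‖) • (u - p) - k'⟫ ≤ ‖u - p‖ * ε :=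
    (real_inner_le_norm _ _).trans (mul_le_mul_of_nonneg_left hkk hn.le)
  have h5 : ⟪u - p, u⟫ ≤ ‖u - p‖ * (r - ε) :=
    (real_inner_le_norm _ _).trans (mul_le_mul_of_nonneg_left hur hn.le)
  rw [real_inner_self_eq_norm_sq] at h2
  nlinarith

/-- Stretch the defect: `(r / ε) • (Y - p) = a - s` with `a ∈ A`, `s ∈ C`. For `t = ε / (ε + r)` the
defects cancel, and `(1 - t) • Y + t • s = (1 - t) • p + t • a` is in `A` by convexity. -/
theorem exists_convex_combination_mem {A C : Set E} {U : Submodule ℝ E} (hA : Convex ℝ A) {r ε : ℝ}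
    (hr : 0 < r) (hball : ∀ u ∈ U, ‖u‖ ≤ r → u ∈ A - C) {Y p : E} (hp : p ∈ A)
    (hU : Y - p ∈ U) (hε : ‖Y - p‖ ≤ ε) :
    ∃ t : ℝ, 0 ≤ t ∧ t ≤ 1 ∧ t ≤ ε / r ∧ ∃ s ∈ C, (1 - t) • Y + t • s ∈ A := by
  have hε0 : 0 ≤ ε := (norm_nonneg _).trans hε
  have hεr : 0 < ε + r := by positivity
  obtain ⟨a, ha, s, hs, has⟩ := hball ((r / ε) • (Y - p)) (U.smul_mem _ hU) (by
    rw [norm_smul, Real.norm_of_nonneg (by positivity)]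
    rcases hε0.eq_or_lt with rfl | h
    -- For `ε = 0` the convention `r / 0 = 0` applies; then `Y = p` and `t = 0`.
    · simpa using hr.le
    · calc r / ε * ‖Y - p‖ ≤ r / ε * ε := by gcongr
        _ = r := by field_simp)
  refine ⟨ε / (ε + r), by positivity, (div_le_one hεr).2 (by linarith), ?_, s, hs, ?_⟩
  · exact div_le_div_of_nonneg_left hε0 hr (by linarith)
  · have h1 : (1 - ε / (ε + r)) = r / (ε + r) := by field_simp; ring
    have h2 : s = a - (r / ε) • (Y - p) := by rw [← has]; exact (sub_sub_cancel a s).symm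
    have h3 : (ε / (ε + r)) • (r / ε) • (Y - p) = (r / (ε + r)) • (Y - p) := by
      rcases hε0.eq_or_lt with rfl | h
      · have : Y - p = 0 := norm_le_zero_iff.1 hε
        simp [this]
      · rw [smul_smul]
        congr 1
        field_simp
    have h4 : (1 - ε / (ε + r)) • Y + (ε / (ε + r)) • s =
        (r / (ε + r)) • p + (ε / (ε + r)) • a := by
      rw [h1, h2, smul_sub, h3, smul_sub]
      abel
    rw [h4]
    exact hA hp ha (by positivity) (by positivity) (by field_simp; ring)

end Convex

variable {T : ℕ} {M B : ℝ} {G : NonatomicGame T}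

/-- If `x + w` were outside `C`, the segment from `x` to `x + w`, which stays in the span, would
cross the relative boundary at distance at most `η` from `x`. -/
theorem add_mem_of_lt_infEDist_relBoundary {C : Set (Act T)} {x w : Act T} {η : ℝ} (hη : 0 ≤ η)
    (hx : x ∈ C) (hd : ENNReal.ofReal η < Metric.infEDist x (relBoundary C))
    (hw : w ∈ Submodule.span ℝ C) (hwη : ‖w‖ ≤ η) : x + w ∈ C := by
  by_contra hxw
  set S := Submodule.span ℝ C
  let a : S := ⟨x, Submodule.subset_span hx⟩
  let b : S := a + ⟨w, hw⟩
  have hconn : IsPreconnected (segment ℝ a b) := (convex_segment a b).isPreconnected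
  obtain ⟨q, hq, hqf⟩ := inter_frontier_nonempty_of_isPreconnected hconn
    (t := ((↑) : S → Act T) ⁻¹' C) ⟨a, left_mem_segment ℝ a b, hx⟩
    ⟨b, right_mem_segment ℝ a b, hxw⟩
  have hmem : (q : Act T) ∈ relBoundary C := ⟨q, hqf, rfl⟩
  have h1 := hd.trans_le (Metric.infEDist_le_edist_of_mem hmem)
  rw [edist_dist, ENNReal.ofReal_lt_ofReal_iff_of_nonneg hη, dist_eq_norm] at h1
  rw [segment_eq_image'] at hq
  obtain ⟨t, ht, rfl⟩ := hq
  have h2 : x - ((a + t • (b - a) : S) : Act T) = -(t • w) := by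
    simp [a, b]
  rw [h2, norm_neg, norm_smul, Real.norm_of_nonneg ht.1] at h1
  nlinarith [norm_nonneg w, ht.2]

theorem convex_profiles (hact : G.RegularActions M) {x y : I → Act T} (hx : x ∈ G.profiles)
    (hy : y ∈ G.profiles) {a b : ℝ} (ha : 0 ≤ a) (hb : 0 ≤ b) (hab : a + b = 1) :
    a • x + b • y ∈ G.profiles := by
  refine ⟨(hx.1.const_smul a).add (hy.1.const_smul b), ?_⟩
  filter_upwards [hx.2, hy.2] with θ h1 h2
  exact hact.convex θ h1 h2 ha hb hab

/-- Integrals of bounded fields of directions in the spans of the action sets belong to the span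
of the differences of constraints and aggregates. -/
theorem integral_mem_span_sub (hI : G.UniformInterior) {A : Set (Act T)} (hA : A.Nonempty)
    {f : I → Act T} (hfm : AEStronglyMeasurable f volume) {C : ℝ} (hfC : ∀ᵐ θ, ‖f θ‖ ≤ C)
    (hf : ∀ᵐ θ, f θ ∈ Submodule.span ℝ (G.act θ)) :
    ∫ θ, f θ ∈ Submodule.span ℝ (A - G.aggregates) := by
  obtain ⟨η, hη, x, hx, hxη⟩ := hI
  obtain ⟨a, ha⟩ := hA
  have hfL : MemLp f 2 volume := MemLp.of_bound hfm C hfC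
  -- Scaled by `τ`, the field has norm at most `η`, so the interior profile can be moved along it;
  -- the integral of `f` is then a multiple of the difference of two aggregates.
  set τ := η / (|C| + 1) with hτ
  have hτ0 : 0 < τ := by positivity
  have hmem : x + τ • f ∈ G.profiles := by
    refine ⟨hx.1.add (hfL.const_smul τ), ?_⟩
    filter_upwards [hx.2, hxη, hfC, hf] with θ h1 h2 h3 h4
    refine add_mem_of_lt_infEDist_relBoundary hη.le h1 h2 (Submodule.smul_mem _ _ h4) ?_
    change ‖τ • f θ‖ ≤ η
    rw [norm_smul, Real.norm_of_nonneg hτ0.le, hτ, div_mul_eq_mul_div, div_le_iff₀ (by positivity)]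
    exact mul_le_mul_of_nonneg_left (by linarith [le_abs_self C]) hη.le
  have h1 : ∫ θ, (x + τ • f) θ = (∫ θ, x θ) + τ • ∫ θ, f θ := by
    have hxi := hx.1.integrable (by norm_num)
    have hfi := hfL.integrable (by norm_num)
    rw [← integral_smul]
    exact integral_add hxi (hfi.smul τ)
  have h2 : ∫ θ, f θ = τ⁻¹ • ((a - ∫ θ, x θ) - (a - ∫ θ, (x + τ • f) θ)) := by
    rw [h1, sub_sub_sub_cancel_left, add_sub_cancel_left, smul_smul, inv_mul_cancel₀ hτ0.ne',
      one_smul]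
  rw [h2]
  exact Submodule.smul_mem _ _ (Submodule.sub_mem _
    (Submodule.subset_span (Set.sub_mem_sub ha ⟨x, hx, rfl⟩))
    (Submodule.subset_span (Set.sub_mem_sub ha ⟨_, hmem, rfl⟩)))

end AggGame

/-! ### Approximation of profiles under aggregative constraints -/

namespace AggGame

variable {T : ℕ} {M B : ℝ} {G : NonatomicGame T} {F : FiniteGame T} {P : PlayerPartition F.n}
  {A A' : Set (Act T)} {e : ℝ}

theorem exists_norm_sub_le_of_infEDist_le {S : Set (Act T)} (hS : IsCompact S) {x : Act T}
    (he : 0 ≤ e) (h : Metric.infEDist x S ≤ ENNReal.ofReal e) : ∃ y ∈ S, ‖x - y‖ ≤ e := by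
  obtain ⟨y, hy, hxy⟩ := hS.exists_infEDist_eq_edist (nonempty_of_infEDist_le h) x
  rw [hxy, edist_dist, ENNReal.ofReal_le_ofReal_iff he, dist_eq_norm] at h
  exact ⟨y, hy, h⟩

/-- The nearest-point profile has its aggregate within `2 * e` of `A`: `e` from the action gap and
`e` from the constraint gap. Mixing in a profile `q` with weight at most `2 * e / r` repairs this
and moves each action by at most that weight times `2 * M`. -/
theorem exists_constrProfile_near_lift (hact : G.RegularActions M) (hA : Convex ℝ A)
    (hAc : IsCompact A) {r : ℝ} (hr : 0 < r)
    (hball : ∀ u ∈ Submodule.span ℝ (A - G.aggregates), ‖u‖ ≤ r → u ∈ A - G.aggregates)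
    (he : 0 ≤ e) (hgap : actionGap G F P ≤ ENNReal.ofReal e)
    (hD : Metric.hausdorffEDist A' A ≤ ENNReal.ofReal e) {x : Fin F.n → Act T}
    (hx : x ∈ F.constrProfiles A') :
    ∃ y ∈ G.constrProfiles A, ∀ᵐ θ, ‖y θ - P.lift x θ‖ ≤ e + 2 * e / r * (2 * M) := by
  obtain ⟨y, hy, hyx⟩ := exists_profile_near_lift hact he hgap hx.1
  obtain ⟨p, hp, hxp⟩ := exists_norm_sub_le_of_infEDist_le hAc he
    ((Metric.infEDist_le_hausdorffEDist_of_mem hx.2).trans hD)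
  have hyi := hy.1.integrable (by norm_num)
  have hYx := norm_integral_sub_le hyi ((P.memLp_lift x 1).integrable le_rfl) hyx
  rw [P.integral_lift] at hYx
  have hYp : ‖(∫ θ, y θ) - p‖ ≤ 2 * e := by
    linarith [norm_sub_le_norm_sub_add_norm_sub (∫ θ, y θ) (∑ i, x i) p]
  have hU : (∫ θ, y θ) - p ∈ Submodule.span ℝ (A - G.aggregates) := by
    have h := Submodule.neg_mem (Submodule.span ℝ (A - G.aggregates))
      (Submodule.subset_span (Set.sub_mem_sub hp ⟨y, hy, rfl⟩))
    rwa [neg_sub] at h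
  obtain ⟨t, ht0, ht1, htr, s, ⟨q, hq, rfl⟩, hs⟩ :=
    exists_convex_combination_mem hA hr hball hp hU hYp
  have hqi := hq.1.integrable (by norm_num)
  refine ⟨(1 - t) • y + t • q,
    ⟨convex_profiles hact hy hq (by linarith) ht0 (by ring), ?_⟩, ?_⟩
  · convert hs using 1
    rw [← integral_smul, ← integral_smul]
    exact integral_add (hyi.smul _) (hqi.smul _)
  · filter_upwards [hyx, hy.2, hq.2] with θ h1 h2 h3
    have e1 : ((1 - t) • y + t • q) θ - P.lift x θ = (y θ - P.lift x θ) + t • (q θ - y θ) := by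
      simp only [Pi.add_apply, Pi.smul_apply]
      module
    rw [e1]
    refine (norm_add_le _ _).trans (add_le_add h1 ?_)
    rw [norm_smul, Real.norm_of_nonneg ht0]
    refine mul_le_mul htr ?_ (norm_nonneg _) (by positivity)
    linarith [norm_sub_le (q θ) (y θ), norm_le_of_act hact h2, norm_le_of_act hact h3]

theorem FiniteGame.isCompact_aggregates (hF : F.RegularActions) : IsCompact F.aggregates := by
  have : F.aggregates = (fun x : Fin F.n → Act T => ∑ i, x i) '' Set.pi Set.univ F.act := by
    ext Y
    simp [FiniteGame.aggregates, FiniteGame.profiles, Set.mem_pi]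
  rw [this]
  exact (isCompact_univ_pi hF.compact).image (by fun_prop)

theorem FiniteGame.convex_profiles (hF : F.RegularActions) : Convex ℝ F.profiles :=
  fun _ hx _ hy _ _ ha hb hab i => hF.convex i (hx i) (hy i) ha hb hab

theorem FiniteGame.convex_aggregates (hF : F.RegularActions) : Convex ℝ F.aggregates := by
  rintro _ ⟨x, hx, rfl⟩ _ ⟨y, hy, rfl⟩ a b ha hb hab
  refine ⟨a • x + b • y, FiniteGame.convex_profiles hF hx hy ha hb hab, ?_⟩
  simp [Finset.sum_add_distrib, Finset.smul_sum]

/-- Defects of the finite game can be repaired only along `U`. Nonatomic profiles and lifts of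
finite ones both take values in the spans of the `G.act θ`, so by `integral_mem_span_sub` all
aggregates lie in `U`; adding an aggregate to `A - G.aggregates` puts `A` in `U`, and `A'` lies in
the span of `A`. -/
theorem sub_aggregates_subset_span (hact : G.RegularActions M) (hI : G.UniformInterior)
    (hA : A.Nonempty)
    (hspan : ∀ i, ∀ θ ∈ P.cell i, Submodule.span ℝ (F.act i) = Submodule.span ℝ (G.act θ))
    (hspanA : Submodule.span ℝ A = Submodule.span ℝ A') :
    A' - F.aggregates ⊆ Submodule.span ℝ (A - G.aggregates) := by
  set U := Submodule.span ℝ (A - G.aggregates) with hUdef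
  have hGU : ∀ Y ∈ G.aggregates, Y ∈ U := by
    rintro _ ⟨x, hx, rfl⟩
    exact integral_mem_span_sub hI hA hx.1.1 (hx.2.mono fun θ h => norm_le_of_act hact h)
      (hx.2.mono fun θ h => Submodule.subset_span h)
  have hFU : ∀ Y ∈ F.aggregates, Y ∈ U := by
    rintro _ ⟨x, hx, rfl⟩
    rw [← P.integral_lift]
    refine integral_mem_span_sub hI hA (P.aestronglyMeasurable_lift x)
      (C := ∑ i, ‖x i‖ / P.weight i) ?_ ?_
    · refine P.norm_lift_le fun i => ?_
      have hw := P.weight_pos i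
      rw [mul_comm, ← div_le_iff₀ hw]
      exact Finset.single_le_sum (f := fun i => ‖x i‖ / P.weight i)
        (fun j _ => div_nonneg (norm_nonneg _) (P.weight_pos j).le) (Finset.mem_univ i)
    · filter_upwards [P.ae_mem_cell] with θ ⟨i, hi⟩
      rw [P.lift_apply x hi, ← hspan i θ hi]
      exact Submodule.smul_mem _ _ (Submodule.subset_span (hx i))
  have hne : G.aggregates.Nonempty := by
    obtain ⟨_, _, x, hx, _⟩ := hI
    exact ⟨_, x, hx, rfl⟩
  obtain ⟨Y, hY⟩ := hne
  have hAU : Submodule.span ℝ A ≤ U := by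
    rw [Submodule.span_le]
    intro a ha
    have h1 : a - Y ∈ U := Submodule.subset_span (Set.sub_mem_sub ha hY)
    have h2 := U.add_mem h1 (hGU Y hY)
    rwa [sub_add_cancel] at h2
  rintro _ ⟨a, ha, Z, hZ, rfl⟩
  refine U.sub_mem (hAU ?_) (hFU Z hZ)
  rw [hspanA]
  exact Submodule.subset_span ha

/-- The same mixing, now with a ball of radius `r / 2` in `A' - F.aggregates`: this set is `2 *
e`-close to `A - G.aggregates`, and `2 * e ≤ r / 2`. Rescaled finite actions have norm at most `M +
e ≤ M + 1`, whence the diameter bound `2 * (M + 1)`. -/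
theorem exists_finite_constrProfile_near (hact : G.RegularActions M)
    (hF : F.RegularActions) (hA' : Convex ℝ A') (hAc' : IsCompact A')
    (hU : A' - F.aggregates ⊆ Submodule.span ℝ (A - G.aggregates)) {r : ℝ} (hr : 0 < r)
    (hball : ∀ u ∈ Submodule.span ℝ (A - G.aggregates), ‖u‖ ≤ r → u ∈ A - G.aggregates)
    (he : 0 ≤ e) (he1 : e ≤ 1) (her : 2 * e ≤ r / 2) (hgap : actionGap G F P ≤ ENNReal.ofReal e)
    (hD : Metric.hausdorffEDist A' A ≤ ENNReal.ofReal e) {x : I → Act T}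
    (hx : x ∈ G.constrProfiles A) :
    ∃ z ∈ F.constrProfiles A', ∀ i, ‖z i - ∫ θ in P.cell i, x θ‖ ≤
      P.weight i * (e + 2 * e / (r / 2) * (2 * (M + 1))) := by
  have hnearA : ∀ a ∈ A, ∃ a' ∈ A', ‖a - a'‖ ≤ e := fun a ha =>
    exists_norm_sub_le_of_infEDist_le hAc' he
      ((Metric.infEDist_le_hausdorffEDist_of_mem ha).trans
        (by rwa [Metric.hausdorffEDist_comm]))
  have hball' : ∀ u ∈ Submodule.span ℝ (A - G.aggregates), ‖u‖ ≤ r / 2 →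
      u ∈ A' - F.aggregates := by
    intro u hu hur
    refine mem_of_ball_subset_of_near (ε := 2 * e) (hA'.sub (FiniteGame.convex_aggregates hF))
      (by
        rw [sub_eq_add_neg]
        exact hAc'.add (FiniteGame.isCompact_aggregates hF).neg) hU hr hball ?_ hu (by linarith)
    rintro _ ⟨a, ha, _, ⟨w, hw, rfl⟩, rfl⟩
    obtain ⟨a', ha', haa⟩ := hnearA a ha
    obtain ⟨z, hz, hzw⟩ := exists_finite_profile_near hF he hgap hw
    have hZ := norm_sum_sub_integral_le P (hw.1.integrable (by norm_num)) hzw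
    refine ⟨a' - ∑ i, z i, Set.sub_mem_sub ha' ⟨z, hz, rfl⟩, ?_⟩
    have : (a - ∫ θ, w θ) - (a' - ∑ i, z i) = (a - a') + (∑ i, z i - ∫ θ, w θ) := by abel
    simp only [this]
    linarith [norm_add_le (a - a') (∑ i, z i - ∫ θ, w θ)]
  obtain ⟨z, hz, hzx⟩ := exists_finite_profile_near hF he hgap hx.1
  have hZ := norm_sum_sub_integral_le P (hx.1.1.integrable (by norm_num)) hzx
  obtain ⟨p, hp, hxp⟩ := hnearA _ hx.2
  have hZp : ‖(∑ i, z i) - p‖ ≤ 2 * e := by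
    linarith [norm_sub_le_norm_sub_add_norm_sub (∑ i, z i) (∫ θ, x θ) p]
  have hZU : (∑ i, z i) - p ∈ Submodule.span ℝ (A - G.aggregates) := by
    have h := Submodule.neg_mem _ (hU (Set.sub_mem_sub hp ⟨z, hz, rfl⟩))
    rwa [neg_sub] at h
  obtain ⟨t, ht0, ht1, htr, s, ⟨q, hq, rfl⟩, hs⟩ :=
    exists_convex_combination_mem hA' (by positivity) hball' hp hZU hZp
  refine ⟨(1 - t) • z + t • q,
    ⟨FiniteGame.convex_profiles hF hz hq (by linarith) ht0 (by ring), ?_⟩, fun i => ?_⟩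
  · convert hs using 1
    simp [Finset.sum_add_distrib, Finset.smul_sum]
  · have e1 : ((1 - t) • z + t • q) i - ∫ θ in P.cell i, x θ =
        (z i - ∫ θ in P.cell i, x θ) + t • (q i - z i) := by
      simp only [Pi.add_apply, Pi.smul_apply]
      module
    have hw := P.weight_pos i
    rw [e1, mul_add]
    refine (norm_add_le _ _).trans (add_le_add (hzx i) ?_)
    rw [norm_smul, Real.norm_of_nonneg ht0, mul_left_comm]
    refine mul_le_mul htr ?_ (norm_nonneg _) (by positivity)
    have h1 := norm_finite_act_le hact he hgap (hq i)
    have h2 := norm_finite_act_le hact he hgap (hz i)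
    have h3 : P.weight i * (M + e) ≤ P.weight i * (M + 1) := by gcongr
    linarith [norm_sub_le (q i) (z i)]

end AggGame

/-! ### Error bounds and convergence -/

namespace AggGame

variable {T : ℕ} {M B : ℝ} {G : NonatomicGame T} {F : FiniteGame T} {P : PlayerPartition F.n}
  {A A' : Set (Act T)} {e : ℝ}

theorem eLpNorm_two_sq {f : I → Act T} (hf : MemLp f 2 volume) :
    eLpNorm f 2 volume ^ 2 = ENNReal.ofReal (∫ θ, ‖f θ‖ ^ 2) := by
  rw [hf.eLpNorm_eq_integral_rpow_norm (by norm_num) (by norm_num), ← ENNReal.ofReal_pow]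
  · congr 1
    have h0 : 0 ≤ ∫ θ, ‖f θ‖ ^ (2 : ℝ) := integral_nonneg fun θ => by positivity
    rw [ENNReal.toReal_ofNat, ← Real.rpow_natCast, ← Real.rpow_mul h0]
    norm_num
  · exact Real.rpow_nonneg (integral_nonneg fun θ => by positivity) _

/-- Reduces the extended bound to a real one: an infinite subgradient gap makes the right side
infinite, and otherwise `d' = d.toReal` is admissible. -/
theorem ofReal_le_mul_errorTerm (hM : 0 < M) (hB : 0 < B) {K V m : ℝ} (hK : 0 ≤ K) (hm : 0 < m)
    {D δ d : ℝ≥0∞} (he : 0 ≤ e) (hmax : max D δ = ENNReal.ofReal e)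
    (h : ∀ d' : ℝ, 0 ≤ d' → d ≤ ENNReal.ofReal d' →
      m * V ≤ (3 * B + 1) * K * e + (2 * M + 1) * d') :
    ENNReal.ofReal V ≤ ENNReal.ofReal (1 / m) * errorTerm M B K D δ d := by
  rw [errorTerm, hmax]
  rcases eq_or_ne d ⊤ with rfl | hd
  · rw [ENNReal.mul_top, add_top, ENNReal.mul_top]
    · exact le_top
    · simpa using hm
    · simpa using (by linarith : 0 < 2 * M + 1)
  · have h' := h d.toReal ENNReal.toReal_nonneg (ENNReal.ofReal_toReal hd).ge
    rw [← ENNReal.ofReal_toReal hd, ← ENNReal.ofReal_mul (by positivity),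
      ← ENNReal.ofReal_mul (by positivity), ← ENNReal.ofReal_add (by positivity) (by positivity),
      ← ENNReal.ofReal_mul (by positivity)]
    refine ENNReal.ofReal_le_ofReal ?_
    rw [one_div, ← div_eq_inv_mul, le_div_iff₀ hm]
    linarith

theorem tendsto_zero_of_sq_le_errorTerm {u D δ d : ℕ → ℝ≥0∞} {K m : ℝ}
    (hD : Tendsto D atTop (𝓝 0)) (hδ : Tendsto δ atTop (𝓝 0)) (hd : Tendsto d atTop (𝓝 0))
    (h : ∀ᶠ ν in atTop, u ν ^ 2 ≤ ENNReal.ofReal m * errorTerm M B K (D ν) (δ ν) (d ν)) :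
    Tendsto u atTop (𝓝 0) := by
  have h1 : Tendsto (fun ν => ENNReal.ofReal m * errorTerm M B K (D ν) (δ ν) (d ν)) atTop
      (𝓝 0) := by
    have h2 : Tendsto (fun ν => errorTerm M B K (D ν) (δ ν) (d ν)) atTop (𝓝 (0 + 0)) := by
      refine Tendsto.add ?_ ?_
      · have := ENNReal.Tendsto.const_mul (hD.max hδ) (Or.inr
          (ENNReal.ofReal_ne_top (r := (3 * B + 1) * K)))
        simpa using this
      · have := ENNReal.Tendsto.const_mul hd (Or.inr (ENNReal.ofReal_ne_top (r := 2 * M + 1)))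
        simpa using this
    have := ENNReal.Tendsto.const_mul h2 (Or.inr (ENNReal.ofReal_ne_top (r := m)))
    simpa using this
  have h3 : Tendsto (fun ν => u ν ^ 2) atTop (𝓝 0) :=
    tendsto_of_tendsto_of_tendsto_of_le_of_le' tendsto_const_nhds h1
      (Eventually.of_forall fun _ => zero_le) h
  have h4 := ((ENNReal.continuous_rpow_const (y := 1 / 2)).tendsto 0).comp h3
  rw [ENNReal.zero_rpow_of_pos (by norm_num)] at h4
  refine h4.congr fun ν => ?_
  simp only [Function.comp_apply]
  rw [← ENNReal.rpow_natCast, ← ENNReal.rpow_mul]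
  norm_num

/-- The error bounds for a profile of a finite game as an approximation of a nonatomic profile. -/
def ErrorBounds (M B K : ℝ) (D : ℝ≥0∞) (G : NonatomicGame T) (P : PlayerPartition F.n)
    (xs : I → Act T) (xh : Fin F.n → Act T) : Prop :=
    (∀ β > 0, G.AggStronglyMonotone M β → ‖(∑ i, xh i) - ∫ θ, xs θ‖ₑ ^ 2 ≤
      ENNReal.ofReal (1 / β) * errorTerm M B K D (actionGap G F P) (subgradGap M G F P)) ∧
    (∀ α > 0, G.StronglyMonotone M α → eLpNorm (P.lift xh - xs) 2 volume ^ 2 ≤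
      ENNReal.ofReal (1 / α) * errorTerm M B K D (actionGap G F P) (subgradGap M G F P))

/-- Error bounds for one finite game, given feasible approximations of the two equilibria. -/
theorem equilibrium_error_bounds (hM : 0 < M) (hB : 0 < B) (hact : G.RegularActions M)
    (hcost : G.RegularCosts M B) (hF : F.RegularActions) {C K : ℝ} (hC : 0 ≤ C) (hCK : C ≤ K)
    {D : ℝ≥0∞} (he : 0 ≤ e) (hmax : max D (actionGap G F P) = ENNReal.ofReal e)
    (heC : e + C * e ≤ 1) {xs : I → Act T} (hxs : G.IsVWE A xs) {xh : Fin F.n → Act T}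
    (hxh : F.IsPseudoVNE A' xh)
    (hy : ∃ y ∈ G.constrProfiles A, ∀ᵐ θ, ‖y θ - P.lift xh θ‖ ≤ C * e)
    (hz : ∃ z ∈ F.constrProfiles A',
      ∀ i, ‖z i - ∫ θ in P.cell i, xs θ‖ ≤ P.weight i * (C * e)) :
    ErrorBounds M B K D G P xs xh := by
  obtain ⟨hxs, g, hg, hVI⟩ := hxs
  obtain ⟨y, hy, hyc⟩ := hy
  obtain ⟨z, hz, hzc⟩ := hz
  have hgap : actionGap G F P ≤ ENNReal.ofReal e := hmax ▸ le_max_right _ _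
  have hCe : 0 ≤ C * e := mul_nonneg hC he
  have hψ : P.lift xh ∈ L2 (cube T M) := lift_mem_cube hact hF he (by linarith) hgap hxh.1.1
  have hxL := NonatomicGame.profiles_subset_L2 hact hxs.1
  have key : ∀ d : ℝ, 0 ≤ d → subgradGap M G F P ≤ ENNReal.ofReal d →
      ∃ h ∈ G.H (P.lift xh), ∫ θ, ⟪h θ - g θ, P.lift xh θ - xs θ⟫ ≤
        (3 * B + 1) * K * e + (2 * M + 1) * d := by
    intro d hd hsub
    obtain ⟨h, hh, hle⟩ := exists_mem_H_integral_inner_le hB hact hcost hF he (by linarith) hd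
      hgap hsub hxs.1 hg hVI hxh hy hyc hz hzc
    refine ⟨h, hh, hle.trans ?_⟩
    -- The stability bound is `2 B C e + d (2 M + e + C e)`; the first term fits into `(3 B + 1) K
    -- e`, and `e + C e ≤ 1` leaves `(2 M + 1) d`.
    have h1 : C * e ≤ K * e := mul_le_mul_of_nonneg_right hCK he
    have h2 : 2 * B * (C * e) ≤ (3 * B + 1) * (K * e) :=
      mul_le_mul (by linarith) h1 hCe (by linarith)
    have h3 : d * (e + C * e) ≤ d * 1 := mul_le_mul_of_nonneg_left heC hd
    linarith
  constructor
  · intro β hβ hmono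
    rw [← ofReal_norm, ← ENNReal.ofReal_pow (norm_nonneg _)]
    refine ofReal_le_mul_errorTerm hM hB (hC.trans hCK) hβ he hmax fun d hd hsub => ?_
    obtain ⟨h, hh, hle⟩ := key d hd hsub
    have := hmono _ hψ _ hxL h hh g hg
    rw [P.integral_lift] at this
    exact this.trans hle
  · intro α hα hmono
    rw [eLpNorm_two_sq (hψ.1.sub hxL.1)]
    refine ofReal_le_mul_errorTerm hM hB (hC.trans hCK) hα he hmax fun d hd hsub => ?_
    obtain ⟨h, hh, hle⟩ := key d hd hsub
    exact (hmono _ hψ _ hxL h hh g hg).trans hle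

theorem eventually_two_mul_lt {u : ℕ → ℝ≥0∞} (hu : Tendsto u atTop (𝓝 0)) {ρ : ℝ} (hρ : 0 < ρ) :
    ∀ᶠ ν in atTop, 2 * u ν < ENNReal.ofReal ρ := by
  have h := ENNReal.Tendsto.const_mul hu (Or.inr (ENNReal.ofNat_ne_top (n := 2)))
  rw [mul_zero] at h
  exact h.eventually (gt_mem_nhds (ENNReal.ofReal_pos.2 hρ))

theorem tendsto_of_enorm_sub {u : ℕ → Act T} {x : Act T}
    (h : Tendsto (fun ν => ‖u ν - x‖ₑ) atTop (𝓝 0)) : Tendsto u atTop (𝓝 x) := by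
  rw [tendsto_iff_edist_tendsto_0]
  simpa [edist_eq_enorm_sub] using h

theorem exists_real_of_two_mul_lt {u : ℝ≥0∞} {ρ : ℝ} (h : 2 * u < ENNReal.ofReal ρ) :
    ∃ e : ℝ, 0 ≤ e ∧ u = ENNReal.ofReal e ∧ 2 * e < ρ := by
  have hu : u ≠ ⊤ := by
    rintro rfl
    simp at h
  refine ⟨u.toReal, ENNReal.toReal_nonneg, (ENNReal.ofReal_toReal hu).symm, ?_⟩
  rw [← ENNReal.ofReal_toReal hu, ← ENNReal.ofReal_ofNat, ← ENNReal.ofReal_mul (by norm_num)] at h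
  exact (ENNReal.ofReal_lt_ofReal_iff_of_nonneg (by positivity)).1 h

end AggGame

/-! ### Choice of the constants and conclusion -/

theorem mainTheorem5 {T : ℕ} {M B : ℝ} (hM : 0 < M) (hB : 0 < B)
    (G : AggGame.NonatomicGame T) (hact : G.RegularActions M) (hcost : G.RegularCosts M B)
    (htech : G.MeasurableReplySubgrad) (hlip : G.ContinuousInAggregate M) :
    -- with aggregative constraints
    (G.UniformInterior →
      ∀ A : Set (AggGame.Act T), Convex ℝ A → IsCompact A →
      (intrinsicInterior ℝ A ∩ intrinsicInterior ℝ G.aggregates).Nonempty →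
      ∃ ρ > 0, ∃ ρ' > 0,
        ∀ (F : ℕ → AggGame.FiniteGame T) (P : ∀ ν, AggGame.PlayerPartition (F ν).n)
          (A' : ℕ → Set (AggGame.Act T)),
        AggGame.IsPseudoAAS M G F P → AggGame.ConstraintsConverge A A' →
        ∀ (xs : I → AggGame.Act T) (xh : ∀ ν, Fin (F ν).n → AggGame.Act T),
        G.IsVWE A xs → (∀ ν, (F ν).IsPseudoVNE (A' ν) (xh ν)) →
        (∀ β > 0, G.AggStronglyMonotone M β →
          Tendsto (fun ν => ∑ i, xh ν i) atTop (𝓝 (∫ θ, xs θ)) ∧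
          ∀ ν, 2 * max (AggGame.actionGap G (F ν) (P ν)) (Metric.hausdorffEDist (A' ν) A)
              < ENNReal.ofReal ρ →
            ‖(∑ i, xh ν i) - ∫ θ, xs θ‖ₑ ^ 2 ≤
              ENNReal.ofReal (1 / β) *
                AggGame.errorTerm M B ((M + 1) / min ρ ρ')
                  (Metric.hausdorffEDist (A' ν) A) (AggGame.actionGap G (F ν) (P ν))
                  (AggGame.subgradGap M G (F ν) (P ν))) ∧
        (∀ α > 0, G.StronglyMonotone M α →
          Tendsto (fun ν => eLpNorm ((P ν).lift (xh ν) - xs) 2 volume) atTop (𝓝 0) ∧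
          ∀ ν, 2 * max (AggGame.actionGap G (F ν) (P ν)) (Metric.hausdorffEDist (A' ν) A)
              < ENNReal.ofReal ρ →
            eLpNorm ((P ν).lift (xh ν) - xs) 2 volume ^ 2 ≤
              ENNReal.ofReal (1 / α) *
                AggGame.errorTerm M B ((M + 1) / min ρ ρ')
                  (Metric.hausdorffEDist (A' ν) A) (AggGame.actionGap G (F ν) (P ν))
                  (AggGame.subgradGap M G (F ν) (P ν)))) ∧
    -- without aggregative constraints: `K_A` and `D` are replaced by `1` and `0`
    (∃ ρ > 0,
      ∀ (F : ℕ → AggGame.FiniteGame T) (P : ∀ ν, AggGame.PlayerPartition (F ν).n)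
        (A : Set (AggGame.Act T)) (A' : ℕ → Set (AggGame.Act T)),
      AggGame.IsPseudoAAS M G F P →
      G.aggregates ⊆ A → (∀ ν, (F ν).aggregates ⊆ A' ν) →
      ∀ (xs : I → AggGame.Act T) (xh : ∀ ν, Fin (F ν).n → AggGame.Act T),
      G.IsVWE A xs → (∀ ν, (F ν).IsPseudoVNE (A' ν) (xh ν)) →
      (∀ β > 0, G.AggStronglyMonotone M β →
        Tendsto (fun ν => ∑ i, xh ν i) atTop (𝓝 (∫ θ, xs θ)) ∧
        ∀ ν, 2 * AggGame.actionGap G (F ν) (P ν) < ENNReal.ofReal ρ →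
          ‖(∑ i, xh ν i) - ∫ θ, xs θ‖ₑ ^ 2 ≤
            ENNReal.ofReal (1 / β) *
              AggGame.errorTerm M B 1 0 (AggGame.actionGap G (F ν) (P ν))
                (AggGame.subgradGap M G (F ν) (P ν))) ∧
      (∀ α > 0, G.StronglyMonotone M α →
        Tendsto (fun ν => eLpNorm ((P ν).lift (xh ν) - xs) 2 volume) atTop (𝓝 0) ∧
        ∀ ν, 2 * AggGame.actionGap G (F ν) (P ν) < ENNReal.ofReal ρ →
          eLpNorm ((P ν).lift (xh ν) - xs) 2 volume ^ 2 ≤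
            ENNReal.ofReal (1 / α) *
              AggGame.errorTerm M B 1 0 (AggGame.actionGap G (F ν) (P ν))
                (AggGame.subgradGap M G (F ν) (P ν)))) := by
  open AggGame in
  refine ⟨fun hI A hA hAc hri => ?_, 1, one_pos, ?_⟩
  · obtain ⟨r, hr, hball⟩ := exists_ball_subset_sub hri
    have hAne : A.Nonempty := by
      obtain ⟨z, hz, -⟩ := hri
      exact ⟨z, intrinsicInterior_subset hz⟩
    -- `C * e` is exactly the error in `exists_finite_constrProfile_near` and dominates the one in
    -- `exists_constrProfile_near_lift`. With `ρ = ρ' = 1 / (1 + C)`, the condition `2 * e < ρ`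
    -- yields both `e + C * e ≤ 1` and `2 * e ≤ r / 2`.
    set C : ℝ := 1 + 8 * (M + 1) / r with hC
    have hq : 0 < 8 * (M + 1) / r := by positivity
    have hρ : 0 < 1 / (1 + C) := by positivity
    refine ⟨1 / (1 + C), hρ, 1 / (1 + C), hρ, fun F P A' hAAS hconv xs xh hxs hxh => ?_⟩
    have bounds : ∀ ν, 2 * max (actionGap G (F ν) (P ν)) (Metric.hausdorffEDist (A' ν) A)
        < ENNReal.ofReal (1 / (1 + C)) →
        ErrorBounds M B ((M + 1) / min (1 / (1 + C)) (1 / (1 + C)))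
          (Metric.hausdorffEDist (A' ν) A) G (P ν) xs (xh ν) := by
      intro ν hν
      obtain ⟨e, he, hmax, heρ⟩ := exists_real_of_two_mul_lt hν
      have heC : 2 * (e * (1 + C)) < 1 := by
        rw [lt_div_iff₀ (by positivity)] at heρ
        linarith
      have hCe : 0 ≤ C * e := by positivity
      have h4 : 8 * (M + 1) / r * e ≤ 1 := by nlinarith
      have her : 2 * e ≤ r / 2 := by
        rw [div_mul_eq_mul_div, div_le_iff₀ hr] at h4
        nlinarith
      have hgap : actionGap G (F ν) (P ν) ≤ ENNReal.ofReal e := hmax ▸ le_max_left _ _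
      have hD : Metric.hausdorffEDist (A' ν) A ≤ ENNReal.ofReal e := hmax ▸ le_max_right _ _
      have hU := sub_aggregates_subset_span (A' := A' ν) hact hI hAne (hAAS.span_eq ν)
        (hconv.span_eq ν)
      obtain ⟨y, hy, hyc⟩ := exists_constrProfile_near_lift hact hA hAc hr hball he hgap hD
        (hxh ν).1
      refine equilibrium_error_bounds (C := C) (K := (M + 1) / min (1 / (1 + C)) (1 / (1 + C)))
        hM hB hact hcost (hAAS.actions ν) (by positivity) ?_ he
        ((max_comm _ _).trans hmax) (by linarith) hxs (hxh ν) ⟨y, hy, ?_⟩ ?_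
      -- `K` equals `(M + 1) * (1 + C)`, which exceeds `C`.
      · rw [min_self, div_div_eq_mul_div, div_one]
        have : 0 < C := by positivity
        nlinarith
      · filter_upwards [hyc] with θ h
        refine h.trans ?_
        have : C * e - (e + 2 * e / r * (2 * M)) = e * (4 * M + 8) / r := by
          rw [hC]
          field_simp
          ring
        have h0 : 0 ≤ e * (4 * M + 8) / r := by positivity
        linarith
      · have h := exists_finite_constrProfile_near hact (hAAS.actions ν) (hconv.convex ν)
          (hconv.compact ν) hU hr hball he (by linarith) her hgap hD hxs.1
        have heq : C * e = e + 2 * e / (r / 2) * (2 * (M + 1)) := by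
          rw [hC]
          field_simp
          ring
        rwa [heq]
    have hmaxt : Tendsto (fun ν => max (actionGap G (F ν) (P ν))
        (Metric.hausdorffEDist (A' ν) A)) atTop (𝓝 0) := by
      simpa using hAAS.actionGap_tendsto.max hconv.tendsto
    have hev := eventually_two_mul_lt hmaxt hρ
    refine ⟨fun β hβ hmono => ⟨tendsto_of_enorm_sub ?_, fun ν hν => (bounds ν hν).1 β hβ hmono⟩,
      fun α hα hmono => ⟨?_, fun ν hν => (bounds ν hν).2 α hα hmono⟩⟩
    · exact tendsto_zero_of_sq_le_errorTerm hconv.tendsto hAAS.actionGap_tendsto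
        hAAS.subgradGap_tendsto (hev.mono fun ν hν => (bounds ν hν).1 β hβ hmono)
    · exact tendsto_zero_of_sq_le_errorTerm hconv.tendsto hAAS.actionGap_tendsto
        hAAS.subgradGap_tendsto (hev.mono fun ν hν => (bounds ν hν).2 α hα hmono)
  · intro F P A A' hAAS hA hA' xs xh hxs hxh
    have bounds : ∀ ν, 2 * actionGap G (F ν) (P ν) < ENNReal.ofReal 1 →
        ErrorBounds M B 1 0 G (P ν) xs (xh ν) := by
      intro ν hν
      obtain ⟨e, he, hgap, he1⟩ := exists_real_of_two_mul_lt hν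
      obtain ⟨y, hy, hyc⟩ := exists_profile_near_lift hact he hgap.le (hxh ν).1.1
      obtain ⟨z, hz, hzc⟩ := exists_finite_profile_near (hAAS.actions ν) he hgap.le hxs.1.1
      -- With `C = 1` the requirement `e + C * e ≤ 1` follows from `2 * e < 1`, which is why `ρ = 1`
      -- works.
      exact equilibrium_error_bounds (C := 1) (K := 1) (D := 0) hM hB hact hcost (hAAS.actions ν)
        zero_le_one le_rfl he (by simpa using hgap) (by linarith) hxs (hxh ν)
        ⟨y, ⟨hy, hA ⟨y, hy, rfl⟩⟩, by simpa using hyc⟩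
        ⟨z, ⟨hz, hA' ν ⟨z, hz, rfl⟩⟩, by simpa using hzc⟩
    have hev := eventually_two_mul_lt hAAS.actionGap_tendsto one_pos
    refine ⟨fun β hβ hmono => ⟨tendsto_of_enorm_sub ?_, fun ν hν => (bounds ν hν).1 β hβ hmono⟩,
      fun α hα hmono => ⟨?_, fun ν hν => (bounds ν hν).2 α hα hmono⟩⟩
    · exact tendsto_zero_of_sq_le_errorTerm tendsto_const_nhds hAAS.actionGap_tendsto
        hAAS.subgradGap_tendsto (hev.mono fun ν hν => (bounds ν hν).1 β hβ hmono)
    · exact tendsto_zero_of_sq_le_errorTerm tendsto_const_nhds hAAS.actionGap_tendsto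
        hAAS.subgradGap_tendsto (hev.mono fun ν hν => (bounds ν hν).2 α hα hmono)
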